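/- Let $\mathbb K$ be a field of characteristic $0$. A curved DG-algebra $(A,d,R)$ is a unital $\mathbb Z$-graded associative $\mathbb K$-algebra $A$ with a degree-one derivation $d$ and an element $R\in A^2$ such that $d(R)=0$ and $d^2(x)=Rx-xR$ for all $x\in A$. Write $[a,b]=ab-(-1)^{|a||b|}ba$ and let $[A,A]$ be the linear span of all graded commutators. A curved Lie ideal is a homogeneous subspace $I\subset A$ with $[A,I]\subset I$, $d(I)\subset I$ and $R\in I$; $I^{(k+1)}A$ denotes the linear span of the products $x_1\cdots x_{k+1}a$ with $x_j\in I$, $a\in A$, and $\operatorname{tr}$ the projection of $A$ onto a quotient of the form $A/([A,A]+I^{(k+1)}A)$. Let $A=B\oplus I$ be a split curved DG-algebra, i.e. $B\subset A$ is a graded Lie subalgebra and $I$ a curved Lie ideal. Let $\imath\colon B\to A$ be the inclusion, $P\colon A\to B$ the projection with kernel $I$, $P^\perp=\mathrm{id}-P$, $\overline\partial=Pd\colon B\to B$ and $\nabla=P^\perp d\colon B\to I$. Then $(B,\overline\partial,[-,-])$ is a DG-Lie algebra, and it is isomorphic to $A/I$. For $i\ge 0$ let $\mathbf C(B,A)_i^m=\operatorname{Hom}^m_{\mathbb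 K}(B[1]^{\odot i},A)$ (graded symmetric multilinear maps of degree $m$), with the convolution product $$(f\star g)(x_1,\dots,x_{i+j})=\sum_{\tau\in S(i,j)}\varepsilon(\tau)(-1)^{|g|(|x_{\tau(1)}|+\cdots+|x_{\tau(i)}|-i)}f(x_{\tau(1)},\dots,x_{\tau(i)})\,g(x_{\tau(i+1)},\dots,x_{\tau(i+j)})$$ for $f$, $g$ of arities $i$, $j$, where $S(i,j)$ is the set of $(i,j)$-unshuffles, $\varepsilon(\tau)$ is the symmetric Koszul sign in $B[1]^{\odot(i+j)}$ and $|x|$ is the degree of $x$ in $B$. Thus $R$, $\nabla$, $\imath\star\imath$ are elements of degree $2$ and of arity $0,1,2$, and $\imath$ has degree $1$ and arity $1$. For $k\ge 0$ let $$V^k=\frac1{k!}\int_0^1\bigl(Z_0+tZ_1+(t^2-t)Z_2\bigr)^k\,dt\in\mathbb K\langle Z_0,Z_1,Z_2\rangle$$ ($t$ a central indeterminate), and let $V^k=\sum_{i=0}^{2k}V^k_i$ be its decomposition into isobaric components, $Z_j$ having weight $j$. Then, for every $k\ge0$ and $1\le i\le 2k+1$, the element $V^k_{i-1}(R,\nabla,\imath\star\imath)\star\imath$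 belongs to $\mathbf C(B,A)^{2k+1}_i$. Let $$\sigma^k_i\in\operatorname{Hom}^0_{\mathbb K}\Bigl(B[1]^{\odot i},\tfrac{A}{[A,A]+I^{(k+1)}A}[2k+1]\Bigr)$$ be its image under $\operatorname{tr}$. Then $$\sigma^k=(\sigma^k_1,\sigma^k_2,\dots,\sigma^k_{2k+1},0,0,\dots)\colon B\rightsquigarrow\frac{A}{[A,A]+I^{(k+1)}A}[2k]$$ is an $L_\infty$ morphism of DG-Lie algebras, where the target has trivial bracket and the differential induced by $d$. Here the bar construction of a DG-Lie algebra $(L,d,[-,-])$ is $S(L[1])$ with the coderivation whose Taylor coefficients are $q_1(x)=-d(x)$, $q_2(x,y)=(-1)^{|x|}[x,y]$, and $q_n=0$ for $n\ge3$, and an $L_\infty$ morphism is given by the Taylor coefficients of a morphism of DG-coalgebras between bar constructions. The linear component of $\sigma^k$ is the $k$-th semiregularity map $A/I\to A/([A,A]+I^{(k+1)}A)[2k]$, $x\mapsto\frac1{k!}\operatorname{tr}(R^kx)$, under the isomorphism $B\cong A/I$. -/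

import Mathlib

noncomputable section

/-! ### DG-Lie algebras -/

/-- A DG-Lie algebra over `K` with underlying vector space `L = ⨁ i, L^i`
(homogeneous parts `deg i`). The bracket is given on homogeneous elements. -/
structure DGLieAlgebra (K : Type*) [Field K] (L : Type*) [AddCommGroup L] [Module K L] where
  deg : ℤ → Submodule K L
  isInternal : DirectSum.IsInternal deg
  d : L →ₗ[K] L
  d_mem : ∀ (i : ℤ) (x : L), x ∈ deg i → d x ∈ deg (i + 1)
  d_d : ∀ x : L, d (d x) = 0
  bracket : ∀ i j : ℤ, deg i →ₗ[K] deg j →ₗ[K] deg (i + j)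
  bracket_skew : ∀ (i j : ℤ) (x : deg i) (y : deg j),
    (bracket i j x y : L) = -(Int.negOnePow (i * j) • (bracket j i y x : L))
  bracket_jacobi : ∀ (i j l : ℤ) (x : deg i) (y : deg j) (z : deg l),
    (bracket i (j + l) x (bracket j l y z) : L) =
      (bracket (i + j) l (bracket i j x y) z : L)
        + Int.negOnePow (i * j) • (bracket j (i + l) y (bracket i l x z) : L)
  d_bracket : ∀ (i j : ℤ) (x : deg i) (y : deg j),
    d (bracket i j x y : L) =
      (bracket (i + 1) j ⟨d x, d_mem i x x.2⟩ y : L)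
        + Int.negOnePow i • (bracket i (j + 1) x ⟨d y, d_mem j y y.2⟩ : L)

/-! ### Multilinear cochains on a graded vector space -/

section Cochains

variable {K : Type*} [Field K] {L : Type*} [AddCommGroup L] [Module K L]
  {W : Type*} [AddCommGroup W] [Module K W]

/-- Homogeneous elements of a graded vector space, together with their degree. -/
abbrev Homog (𝓛 : ℤ → Submodule K L) : Type _ := Σ i : ℤ, 𝓛 i

/-- Since `L^{⊗ n}` is the direct sum over `e : Fin n → ℤ` of `L^{e 0} ⊗ ⋯ ⊗ L^{e (n-1)}`, a linear
map `L^{⊗ n} → W` is a family of multilinear maps indexed by `e`. An element of `Cochain 𝓛 W` is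
a family of such maps, one for every arity `n`. -/
abbrev Cochain (𝓛 : ℤ → Submodule K L) (W : Type*) [AddCommGroup W] [Module K W] : Type _ :=
  ∀ (n : ℕ) (e : Fin n → ℤ), MultilinearMap K (fun j => 𝓛 (e j)) W

variable {𝓛 : ℤ → Submodule K L}

/-- The value of a cochain on a tuple of homogeneous elements. -/
def Cochain.eval (f : Cochain 𝓛 W) {n : ℕ} (v : Fin n → Homog 𝓛) : W :=
  f n (fun j => (v j).1) (fun j => (v j).2)

/-- The subtuple `(v_s)_{s ∈ S}`, in increasing order. -/
def subtuple {X : Type*} {n : ℕ} (v : Fin n → X) (S : Finset (Fin n)) : Fin S.card → X :=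
  fun j => v (S.orderEmbOfFin rfl j)

/-- The `(i, n-i)`-unshuffles `τ` correspond to the subsets `S = {τ(1) < ⋯ < τ(i)}`. This is the
symmetric Koszul sign `ε(τ)` in `L[1]^{⊙ n}`, for elements whose degrees in `L` are `e`: the
elements of `S` are moved to the left of those of the complement, both in increasing order. -/
def unshuffleSign {n : ℕ} (e : Fin n → ℤ) (S : Finset (Fin n)) : ℤˣ :=
  ∏ p ∈ Sᶜ ×ˢ S, if p.1 < p.2 then Int.negOnePow ((e p.1 - 1) * (e p.2 - 1)) else 1

/-- The total degree in `L[1]` of the elements indexed by `S`. -/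
def shiftedDegree {n : ℕ} (e : Fin n → ℤ) (S : Finset (Fin n)) : ℤ := ∑ s ∈ S, (e s - 1)

/-- The cochain factors through the symmetric powers `L[1]^{⊙ n}`. -/
def Cochain.IsSymmetric (f : Cochain 𝓛 W) : Prop :=
  ∀ (n : ℕ) (v : Fin (n + 1) → Homog 𝓛) (i : Fin n),
    f.eval (fun j => v (Equiv.swap i.castSucc i.succ j)) =
      Int.negOnePow (((v i.castSucc).1 - 1) * ((v i.succ).1 - 1)) • f.eval v

/-- The cochain has degree `m`, as a collection of maps `L[1]^{⊗ n} → W` with `W` graded by `𝓦`. -/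
def Cochain.HasDegree (𝓦 : ℤ → Submodule K W) (f : Cochain 𝓛 W) (m : ℤ) : Prop :=
  ∀ (n : ℕ) (v : Fin n → Homog 𝓛), f.eval v ∈ 𝓦 ((∑ j, ((v j).1 - 1)) + m)

/-- Membership in `Hom^m(L[1]^{⊙ i}, W)`, that is, `f ∈ 𝐂(L, W)_i` of degree `m`. -/
structure Cochain.IsHom (𝓦 : ℤ → Submodule K W) (f : Cochain 𝓛 W) (m : ℤ) (i : ℕ) : Prop where
  isSymmetric : f.IsSymmetric
  hasDegree : f.HasDegree 𝓦 m
  eq_zero : ∀ n, n ≠ i → f n = 0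

/-- A linear map `L → W` as a cochain of arity one. -/
def Cochain.ofLinear (𝓛 : ℤ → Submodule K L) (φ : L →ₗ[K] W) : Cochain 𝓛 W
  | 1 => fun e =>
    { toFun := fun x => φ (x 0 : L)
      map_update_add' := by
        intro _ x i a b
        obtain rfl : i = 0 := Subsingleton.elim _ _
        simp
      map_update_smul' := by
        intro _ x i a b
        obtain rfl : i = 0 := Subsingleton.elim _ _
        simp }
  | _ => 0

/-- An element of `W` as a cochain of arity zero. -/
def Cochain.ofElement (𝓛 : ℤ → Submodule K L) (a : W) : Cochain 𝓛 W
  | 0 => fun _ => MultilinearMap.constOfIsEmpty K _ a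
  | _ => 0

/-- Postcomposition with a linear map. -/
def Cochain.map {W' : Type*} [AddCommGroup W'] [Module K W'] (φ : W →ₗ[K] W')
    (f : Cochain 𝓛 W) : Cochain 𝓛 W' :=
  fun n e => φ.compMultilinearMap (f n e)

end Cochains

/-! ### `L_∞` morphisms between DG-Lie algebras -/

section LInfty

variable {K : Type*} [Field K] {L : Type*} [AddCommGroup L] [Module K L]
  {M : Type*} [AddCommGroup M] [Module K M]

/-- The differential on homogeneous elements. -/
def DGLieAlgebra.dHomog (𝔏 : DGLieAlgebra K L) (x : Homog 𝔏.deg) : Homog 𝔏.deg :=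
  ⟨x.1 + 1, ⟨𝔏.d x.2, 𝔏.d_mem x.1 x.2 x.2.2⟩⟩

/-- The bracket on homogeneous elements. -/
def DGLieAlgebra.bracketHomog (𝔏 : DGLieAlgebra K L) (x y : Homog 𝔏.deg) : Homog 𝔏.deg :=
  ⟨x.1 + y.1, 𝔏.bracket x.1 y.1 x.2 y.2⟩

/-- `f ∘ Q` evaluated on `v_1 ⊙ ⋯ ⊙ v_n`, where `Q` is the differential of the bar construction
`S(L[1])`, i.e. the coderivation with Taylor coefficients `q_1(x) = -d x`,
`q_2(x, y) = (-1)^{|x|} [x, y]`. The second sum is over the `(2, n-2)`-unshuffles. -/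
def DGLieAlgebra.compBar (𝔏 : DGLieAlgebra K L) (f : Cochain 𝔏.deg M) {n : ℕ}
    (v : Fin n → Homog 𝔏.deg) : M :=
  ∑ i, Int.negOnePow (shiftedDegree (fun j => (v j).1) (Finset.Iio i)) •
      -f.eval (Function.update v i (𝔏.dHomog (v i)))
    + ∑ p : Fin n × Fin n with p.1 < p.2,
      (unshuffleSign (fun j => (v j).1) {p.1, p.2} * Int.negOnePow (v p.1).1) •
        f.eval (Fin.cons (𝔏.bracketHomog (v p.1) (v p.2)) (subtuple v {p.1, p.2}ᶜ))

/-- `f = (f_1, f_2, …)` is (the sequence of Taylor coefficients of) an `L_∞` morphism `L ⇝ M`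
of DG-Lie algebras: the `f_n : L[1]^{⊙ n} → M[1]` are linear maps of degree zero, and the
morphism of graded coalgebras `S(L[1]) → S(M[1])` with corestriction `f` commutes with the bar
differentials, that is, `r_1 f + r_2 (½ (f ⊙ f) Δ) = f Q`, where `r_1(m) = -d m` and
`r_2(m, m') = (-1)^{|m|} [m, m']`. In the sum over unshuffles the two terms with an empty set
vanish as `f_0 = 0`. -/
structure IsLInftyMorphism (𝔏 : DGLieAlgebra K L) (𝔐 : DGLieAlgebra K M)
    (f : Cochain 𝔏.deg M) : Prop where
  zero : f 0 = 0
  isSymmetric : f.IsSymmetric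
  /-- degree `0` into `M[1]` is degree `1` into `M` -/
  hasDegree : f.HasDegree 𝔐.deg 1
  comm : ∀ (n : ℕ) (v : Fin n → Homog 𝔏.deg),
    -𝔐.d (f.eval v)
      + (2 : K)⁻¹ • ∑ S : Finset (Fin n),
          (unshuffleSign (fun j => (v j).1) S
            * Int.negOnePow ((∑ j, ((subtuple v S j).1 - 1)) + 1)) •
          (𝔐.bracket _ _ ⟨f.eval (subtuple v S), hasDegree _ _⟩
            ⟨f.eval (subtuple v Sᶜ), hasDegree _ _⟩ : M)
      = 𝔏.compBar f v

end LInfty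

/-! ### The convolution product -/

section Convolution

variable {K : Type*} [Field K] {L : Type*} [AddCommGroup L] [Module K L]
  {A : Type*} [Ring A] [Algebra K A] {𝓛 : ℤ → Submodule K L}

theorem update_sub_mem {n : ℕ} {X : Fin n → Type*} [DecidableEq (Fin n)] (x : ∀ j, X j)
    (S : Finset (Fin n)) (j : Fin S.card) (a : X (S.orderEmbOfFin rfl j)) :
    (fun l => Function.update x (S.orderEmbOfFin rfl j) a (S.orderEmbOfFin rfl l)) =
      Function.update (fun l => x (S.orderEmbOfFin rfl l)) j a := by
  ext l
  rcases eq_or_ne l j with rfl | h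
  · simp
  · simp [h]

theorem update_sub_notMem {n : ℕ} {X : Fin n → Type*} [DecidableEq (Fin n)] (x : ∀ j, X j)
    (S : Finset (Fin n)) {i : Fin n} (hi : i ∉ S) (a : X i) :
    (fun l => Function.update x i a (S.orderEmbOfFin rfl l)) =
      fun l => x (S.orderEmbOfFin rfl l) := by
  ext l
  have : S.orderEmbOfFin rfl l ≠ i := fun h => hi (h ▸ S.orderEmbOfFin_mem rfl l)
  simp [this]

theorem exists_emb {n : ℕ} {S : Finset (Fin n)} {i : Fin n} (hi : i ∈ S) :
    ∃ j : Fin S.card, S.orderEmbOfFin rfl j = i := by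
  have := S.range_orderEmbOfFin (rfl : S.card = S.card)
  exact (Set.ext_iff.1 this i).2 hi

/-- The multilinear map `x ↦ f(x_S) g(x_{Sᶜ})`. -/
def subMul {n : ℕ} {e : Fin n → ℤ} (S : Finset (Fin n))
    (f : MultilinearMap K (fun j : Fin S.card => 𝓛 (e (S.orderEmbOfFin rfl j))) A)
    (g : MultilinearMap K (fun j : Fin Sᶜ.card => 𝓛 (e (Sᶜ.orderEmbOfFin rfl j))) A) :
    MultilinearMap K (fun j => 𝓛 (e j)) A where
  toFun x := f (fun j => x (S.orderEmbOfFin rfl j)) * g (fun j => x (Sᶜ.orderEmbOfFin rfl j))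
  map_update_add' := by
    intro inst x i a b
    obtain rfl : inst = instDecidableEqFin n := Subsingleton.elim _ _
    by_cases hi : i ∈ S
    · have hc : i ∉ Sᶜ := by simpa using hi
      obtain ⟨j, rfl⟩ := exists_emb hi
      simp only [update_sub_mem, update_sub_notMem _ _ hc, f.map_update_add, add_mul]
    · obtain ⟨j, rfl⟩ := exists_emb (Finset.mem_compl.2 hi)
      simp only [update_sub_mem, update_sub_notMem _ _ hi, g.map_update_add, mul_add]
  map_update_smul' := by
    intro inst x i a b
    obtain rfl : inst = instDecidableEqFin n := Subsingleton.elim _ _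
    by_cases hi : i ∈ S
    · have hc : i ∉ Sᶜ := by simpa using hi
      obtain ⟨j, rfl⟩ := exists_emb hi
      simp only [update_sub_mem, update_sub_notMem _ _ hc, f.map_update_smul, smul_mul_assoc]
    · obtain ⟨j, rfl⟩ := exists_emb (Finset.mem_compl.2 hi)
      simp only [update_sub_mem, update_sub_notMem _ _ hi, g.map_update_smul, mul_smul_comm]

/-- The convolution product `f ⋆ g`, for `g` homogeneous of degree `p` (only the parity
of `p` matters):
`(f ⋆ g)(x) = ∑_S ε(S) (-1)^{p · |x_S|} f(x_S) g(x_{Sᶜ})`, summed over unshuffles, with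
`|x_S|` the degree of `x_S` in `L[1]^{⊙ |S|}`. -/
def conv (p : ℤ) : Cochain 𝓛 A →ₗ[K] Cochain 𝓛 A →ₗ[K] Cochain 𝓛 A :=
  LinearMap.mk₂ K
    (fun f g n e => ∑ S : Finset (Fin n),
      (unshuffleSign e S * Int.negOnePow (p * shiftedDegree e S)) •
        subMul S (f S.card (fun j => e (S.orderEmbOfFin rfl j)))
          (g Sᶜ.card (fun j => e (Sᶜ.orderEmbOfFin rfl j))))
    (by
      intro f f' g; ext n e x
      simp [subMul, add_mul, Finset.sum_add_distrib])
    (by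
      intro c f g; ext n e x
      simp [subMul, Finset.smul_sum, smul_comm c])
    (by
      intro f g g'; ext n e x
      simp [subMul, mul_add, Finset.sum_add_distrib])
    (by
      intro c f g; ext n e x
      simp [subMul, Finset.smul_sum, smul_comm c])

/-- Left convolution by an element of even degree, acting on elements of even degree. -/
def evenLeftMul (f : Cochain 𝓛 A) : Module.End K (Cochain 𝓛 A) := conv 0 f

/-- `V(Z₀, Z₁, Z₂)` evaluated, with respect to `⋆`, at three elements of even degree of the
convolution algebra: a word `Z_a Z_b ⋯ Z_c` is sent to `z_a ⋆ (z_b ⋆ ⋯ (z_c ⋆ 1))`, and no sign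
occurs since all degrees are even. -/
def evalPoly (z : Fin 3 → Cochain 𝓛 A) (V : FreeAlgebra K (Fin 3)) : Cochain 𝓛 A :=
  FreeAlgebra.lift K (fun j => evenLeftMul (z j)) V (Cochain.ofElement 𝓛 1)

end Convolution

/-! ### The polynomials `V^k` -/

section Polynomials

variable (K : Type*) [Field K]

/-- `∫₀¹ p(t) dt`, for a polynomial in a central indeterminate `t` with coefficients in a
(noncommutative) `K`-algebra. -/
def integral01 {F : Type*} [Ring F] [Algebra K F] (p : Polynomial F) : F :=
  p.sum fun n a => ((n : K) + 1)⁻¹ • a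

/-- `V^k = (1/k!) ∫₀¹ (Z₀ + t Z₁ + (t² - t) Z₂)^k dt` in `K⟨Z₀, Z₁, Z₂⟩`. -/
def csPoly (k : ℕ) : FreeAlgebra K (Fin 3) :=
  (k.factorial : K)⁻¹ • integral01 K
    ((Polynomial.C (FreeAlgebra.ι K 0) + Polynomial.X * Polynomial.C (FreeAlgebra.ι K 1)
      + (Polynomial.X ^ 2 - Polynomial.X) * Polynomial.C (FreeAlgebra.ι K 2)) ^ k)

/-- The isobaric component of weight `i`, where `Z_j` has weight `j`: the coefficient of `s^i`
in `V(Z₀, s Z₁, s² Z₂)`. -/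
def isobaric (i : ℕ) (V : FreeAlgebra K (Fin 3)) : FreeAlgebra K (Fin 3) :=
  (FreeAlgebra.lift K
    (fun j : Fin 3 => Polynomial.monomial (j : ℕ) (FreeAlgebra.ι K j)) V).coeff i

end Polynomials

/-! ### Curved DG-algebras -/

section Curved

variable {K : Type*} [Field K] {A : Type*} [Ring A] [Algebra K A]

/-- The graded commutator `[a, b] = ab - (-1)^{ij} ba` of elements of degrees `i` and `j`. -/
def gradedComm (i j : ℤ) (a b : A) : A := a * b - Int.negOnePow (i * j) • (b * a)

/-- A curved DG-algebra structure on the graded algebra `A = ⨁ i, 𝒜 i`. -/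
structure CurvedDGAlgebra (𝒜 : ℤ → Submodule K A) [GradedAlgebra 𝒜] where
  d : A →ₗ[K] A
  d_mem : ∀ (i : ℤ) (a : A), a ∈ 𝒜 i → d a ∈ 𝒜 (i + 1)
  d_mul : ∀ (i : ℤ) (a b : A), a ∈ 𝒜 i → d (a * b) = d a * b + Int.negOnePow i • (a * d b)
  R : A
  R_mem : R ∈ 𝒜 2
  d_R : d R = 0
  d_d : ∀ a : A, d (d a) = R * a - a * R

/-- `I` is a curved Lie ideal. -/
structure CurvedDGAlgebra.IsCurvedLieIdeal {𝒜 : ℤ → Submodule K A} [GradedAlgebra 𝒜]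
    (C : CurvedDGAlgebra 𝒜) (I : Submodule K A) : Prop where
  isHomogeneous : I.IsHomogeneous 𝒜
  gradedComm_mem : ∀ (i j : ℤ) (a x : A), a ∈ 𝒜 i → x ∈ 𝒜 j → x ∈ I → gradedComm i j a x ∈ I
  d_mem : ∀ x ∈ I, C.d x ∈ I
  R_mem : C.R ∈ I

/-- `B` is a graded Lie subalgebra. -/
structure IsGradedLieSubalgebra (𝒜 : ℤ → Submodule K A) [GradedAlgebra 𝒜]
    (B : Submodule K A) : Prop where
  isHomogeneous : B.IsHomogeneous 𝒜
  gradedComm_mem : ∀ (i j : ℤ) (a b : A), a ∈ 𝒜 i → b ∈ 𝒜 j → a ∈ B → b ∈ B →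
    gradedComm i j a b ∈ B

/-- A split curved DG-algebra `A = B ⊕ I`. -/
structure SplitCurvedDGAlgebra (𝒜 : ℤ → Submodule K A) [GradedAlgebra 𝒜] extends
    CurvedDGAlgebra 𝒜 where
  B : Submodule K A
  I : Submodule K A
  isCompl : IsCompl B I
  B_lie : IsGradedLieSubalgebra 𝒜 B
  I_ideal : toCurvedDGAlgebra.IsCurvedLieIdeal I

/-- `[A, A]`, the linear span of the graded commutators. -/
def commutatorSpan (𝒜 : ℤ → Submodule K A) : Submodule K A :=
  Submodule.span K {c | ∃ (i j : ℤ) (a b : A), a ∈ 𝒜 i ∧ b ∈ 𝒜 j ∧ c = gradedComm i j a b}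

/-- `[A, A] + I^{(k+1)} A`, where `I^{(k+1)} A` is the span of the products
`x_1 ⋯ x_{k+1} a` with `x_j ∈ I`, `a ∈ A`. -/
def traceKernel (𝒜 : ℤ → Submodule K A) (I : Submodule K A) (k : ℕ) : Submodule K A :=
  commutatorSpan 𝒜 ⊔ I ^ (k + 1) * ⊤

theorem isInternal_of_proj {V : Type*} [AddCommGroup V] [Module K V] (𝒱 : ℤ → Submodule K V)
    (p : ℤ → V →ₗ[K] V) (h1 : ∀ i, ∀ x ∈ 𝒱 i, p i x = x)
    (h2 : ∀ i j, i ≠ j → ∀ x ∈ 𝒱 j, p i x = 0) (h3 : ∀ x, x ∈ ⨆ i, 𝒱 i) :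
    DirectSum.IsInternal 𝒱 := by
  rw [DirectSum.isInternal_submodule_iff_iSupIndep_and_iSup_eq_top]
  refine ⟨fun i => ?_, by ext x; simp [h3 x]⟩
  rw [Submodule.disjoint_def]
  intro x hx hx'
  have : (⨆ j, ⨆ (_ : j ≠ i), 𝒱 j) ≤ LinearMap.ker (p i) :=
    iSup₂_le fun j hj y hy => h2 i j hj.symm y hy
  rw [← h1 i x hx]
  exact this hx'

theorem gradedComm_mem_commutatorSpan {𝒜 : ℤ → Submodule K A} {i j : ℤ}
    {a b : A} (ha : a ∈ 𝒜 i) (hb : b ∈ 𝒜 j) :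
    gradedComm i j a b ∈ commutatorSpan 𝒜 :=
  Submodule.subset_span ⟨i, j, a, b, ha, hb, rfl⟩

variable {𝒜 : ℤ → Submodule K A} [GradedAlgebra 𝒜]

/-- The projection of `A` onto its component of degree `i`. -/
def component (𝒜 : ℤ → Submodule K A) [GradedAlgebra 𝒜] (i : ℤ) : A →ₗ[K] A :=
  (𝒜 i).subtype ∘ₗ DirectSum.component K ℤ (fun i => 𝒜 i) i ∘ₗ
    (DirectSum.decomposeLinearEquiv 𝒜).toLinearMap

theorem component_apply (i : ℤ) (a : A) : component 𝒜 i a = DirectSum.decompose 𝒜 a i := rfl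

theorem component_map_le {I : Submodule K A} (hI : I.IsHomogeneous 𝒜) (i : ℤ) :
    I ≤ I.comap (component 𝒜 i) := fun _ hx => hI i hx

theorem gradedComm_deg {i j : ℤ} {a b : A} (ha : a ∈ 𝒜 i) (hb : b ∈ 𝒜 j) :
    gradedComm i j a b ∈ 𝒜 (i + j) := by
  refine sub_mem (SetLike.mul_mem_graded ha hb) ?_
  rw [Units.smul_def]
  exact zsmul_mem (add_comm j i ▸ SetLike.mul_mem_graded hb ha) _

theorem gradedComm_skew (i j : ℤ) (a b : A) :
    gradedComm i j a b = -(Int.negOnePow (i * j) • gradedComm j i b a) := by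
  simp only [gradedComm, Units.smul_def, smul_sub, smul_smul, ← Units.val_mul, mul_comm j i,
    Int.units_mul_self, Units.val_one, one_smul]
  abel

theorem gradedComm_jacobi (i j l : ℤ) (a b c : A) :
    gradedComm i (j + l) a (gradedComm j l b c) =
      gradedComm (i + j) l (gradedComm i j a b) c
        + Int.negOnePow (i * j) • gradedComm j (i + l) b (gradedComm i l a c) := by
  have h : ∀ m n : ℤ, Int.negOnePow (m * n) = 1 ∨ Int.negOnePow (m * n) = -1 := fun m n =>
    Int.units_eq_one_or _
  simp only [gradedComm, mul_add, add_mul, Int.negOnePow_add, mul_comm j i]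
  rcases h i j with h1 | h1 <;> rcases h i l with h2 | h2 <;> rcases h j l with h3 | h3 <;>
    simp only [h1, h2, h3, Units.smul_def, Units.val_one, Units.val_neg, one_smul,
      neg_smul, mul_one, neg_neg, mul_neg] <;> noncomm_ring

theorem gradedComm_sub_left (i j : ℤ) (a a' b : A) :
    gradedComm i j (a - a') b = gradedComm i j a b - gradedComm i j a' b := by
  simp only [gradedComm, sub_mul, mul_sub, Units.smul_def, smul_sub]
  abel

theorem gradedComm_sub_right (i j : ℤ) (a b b' : A) :
    gradedComm i j a (b - b') = gradedComm i j a b - gradedComm i j a b' := by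
  simp only [gradedComm, sub_mul, mul_sub, Units.smul_def, smul_sub]
  abel

theorem isHomogeneous_span {s : Set A} (hs : ∀ x ∈ s, ∃ i, x ∈ 𝒜 i) :
    (Submodule.span K s).IsHomogeneous 𝒜 := by
  intro i x hx
  induction hx using Submodule.span_induction with
  | mem x hx =>
    obtain ⟨j, hj⟩ := hs x hx
    by_cases h : j = i
    · subst h
      rw [DirectSum.decompose_of_mem_same _ hj]
      exact Submodule.subset_span hx
    · rw [DirectSum.decompose_of_mem_ne _ hj h]
      exact zero_mem _
  | zero => simp
  | add x y _ _ hx hy => simpa using add_mem hx hy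
  | smul c x _ hx => 
    rw [DirectSum.decompose_smul]
    exact Submodule.smul_mem _ c hx

theorem isHomogeneous_sup {I J : Submodule K A} (hI : I.IsHomogeneous 𝒜)
    (hJ : J.IsHomogeneous 𝒜) : (I ⊔ J).IsHomogeneous 𝒜 := by
  intro i x hx
  obtain ⟨y, hy, z, hz, rfl⟩ := Submodule.mem_sup.1 hx
  simpa using Submodule.add_mem_sup (hI i hy) (hJ i hz)

theorem mul_mem_of_homogeneous {I J : Submodule K A} {P : Submodule K A}
    (hI : I.IsHomogeneous 𝒜) (hJ : J.IsHomogeneous 𝒜) (φ : A →ₗ[K] A)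
    (h : ∀ (i j : ℤ) (x y : A), x ∈ I → y ∈ J → x ∈ 𝒜 i → y ∈ 𝒜 j → φ (x * y) ∈ P)
    {x : A} (hx : x ∈ I * J) : φ x ∈ P := by
  induction hx using Submodule.mul_induction_on' with
  | mem_mul_mem x hx y hy =>
    classical
    rw [← DirectSum.sum_support_decompose 𝒜 x, ← DirectSum.sum_support_decompose 𝒜 y,
      Finset.sum_mul_sum, map_sum]
    refine sum_mem fun i _ => ?_
    rw [map_sum]
    exact sum_mem fun j _ => h i j _ _ (hI i hx) (hJ j hy) (Subtype.prop _) (Subtype.prop _)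
  | add x _ y _ hx hy => rw [map_add]; exact add_mem hx hy

theorem isHomogeneous_mul {I J : Submodule K A} (hI : I.IsHomogeneous 𝒜)
    (hJ : J.IsHomogeneous 𝒜) : (I * J).IsHomogeneous 𝒜 := by
  intro i x hx
  refine mul_mem_of_homogeneous hI hJ (P := I * J) (component 𝒜 i) ?_ hx
  intro a b x y hx hy ha hb
  have hab := SetLike.mul_mem_graded ha hb
  rw [component_apply]
  by_cases h : a + b = i
  · subst h
    rw [DirectSum.decompose_of_mem_same _ hab]
    exact Submodule.mul_mem_mul hx hy
  · rw [DirectSum.decompose_of_mem_ne _ hab h]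
    exact zero_mem _

theorem isHomogeneous_top : (⊤ : Submodule K A).IsHomogeneous 𝒜 := fun _ _ _ => trivial

theorem isHomogeneous_pow {I : Submodule K A} (hI : I.IsHomogeneous 𝒜) (k : ℕ) :
    (I ^ (k + 1)).IsHomogeneous 𝒜 := by
  induction k with
  | zero => simpa using hI
  | succ k ih => rw [pow_succ]; exact isHomogeneous_mul ih hI

theorem isHomogeneous_traceKernel {I : Submodule K A} (hI : I.IsHomogeneous 𝒜) (k : ℕ) :
    (traceKernel 𝒜 I k).IsHomogeneous 𝒜 := by
  refine isHomogeneous_sup (isHomogeneous_span ?_)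
    (isHomogeneous_mul (isHomogeneous_pow hI k) isHomogeneous_top)
  rintro _ ⟨i, j, a, b, ha, hb, rfl⟩
  exact ⟨i + j, gradedComm_deg ha hb⟩

namespace CurvedDGAlgebra

variable (C : CurvedDGAlgebra 𝒜)

theorem d_gradedComm {i j : ℤ} {a b : A} (ha : a ∈ 𝒜 i) (hb : b ∈ 𝒜 j) :
    C.d (gradedComm i j a b) =
      gradedComm (i + 1) j (C.d a) b + Int.negOnePow i • gradedComm i (j + 1) a (C.d b) := by
  simp only [gradedComm, map_sub, Units.smul_def, map_zsmul, C.d_mul i a b ha, C.d_mul j b a hb,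
    smul_sub, smul_add, smul_smul, ← Units.val_mul, ← Int.negOnePow_add]
  have e1 : Int.negOnePow ((i + 1) * j) = Int.negOnePow (i * j + j) := by congr 1; ring
  have e2 : Int.negOnePow (i + i * (j + 1)) = Int.negOnePow (i * j) := by
    rw [show i + i * (j + 1) = i * j + 2 * i by ring, Int.negOnePow_add, Int.negOnePow_two_mul,
      mul_one]
  rw [e1, e2]
  abel

theorem d_mem_mul {I J : Submodule K A} (hI : I.IsHomogeneous 𝒜) (hJ : J.IsHomogeneous 𝒜)
    (dI : ∀ x ∈ I, C.d x ∈ I) (dJ : ∀ x ∈ J, C.d x ∈ J) : ∀ x ∈ I * J, C.d x ∈ I * J := by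
  intro x hx
  refine mul_mem_of_homogeneous hI hJ C.d ?_ hx
  intro i j x y hx hy hxi _
  rw [C.d_mul i x y hxi, Units.smul_def]
  exact add_mem (Submodule.mul_mem_mul (dI x hx) hy)
    (zsmul_mem (Submodule.mul_mem_mul hx (dJ y hy)) _)

theorem d_mem_traceKernel {I : Submodule K A} (hI : C.IsCurvedLieIdeal I) (k : ℕ) :
    traceKernel 𝒜 I k ≤ (traceKernel 𝒜 I k).comap C.d := by
  have hp : ∀ x ∈ I ^ (k + 1), C.d x ∈ I ^ (k + 1) := by
    induction k with
    | zero => simpa using hI.d_mem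
    | succ k ih =>
      rw [pow_succ]
      exact C.d_mem_mul (isHomogeneous_pow hI.isHomogeneous k) hI.isHomogeneous ih hI.d_mem
  refine sup_le (Submodule.span_le.2 ?_) fun x hx => ?_
  · rintro _ ⟨i, j, a, b, ha, hb, rfl⟩
    refine Submodule.mem_sup_left ?_
    rw [C.d_gradedComm ha hb, Units.smul_def]
    exact add_mem (gradedComm_mem_commutatorSpan (C.d_mem i a ha) hb)
      (zsmul_mem (gradedComm_mem_commutatorSpan ha (C.d_mem j b hb)) _)
  · exact Submodule.mem_sup_right (C.d_mem_mul (isHomogeneous_pow hI.isHomogeneous k)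
      isHomogeneous_top hp (fun _ _ => trivial) x hx)

/-- The abelian DG-Lie algebra `A/([A,A] + I^{(k+1)}A)[2k]`: the part of degree `j` is the image
of `A^{j+2k}`, and the differential is induced by `d` (no sign, as `2k` is even). -/
def traceQuotient {I : Submodule K A} (hI : C.IsCurvedLieIdeal I) (k : ℕ) :
    DGLieAlgebra K (A ⧸ traceKernel 𝒜 I k) where
  deg j := (𝒜 (j + 2 * k)).map (traceKernel 𝒜 I k).mkQ
  isInternal := by
    refine isInternal_of_proj _ (fun i => Submodule.mapQ _ _ (component 𝒜 (i + 2 * k))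
      (component_map_le (isHomogeneous_traceKernel hI.isHomogeneous k) _)) ?_ ?_ ?_
    · rintro i _ ⟨a, ha, rfl⟩
      rw [Submodule.mkQ_apply, Submodule.mapQ_apply, component_apply,
        DirectSum.decompose_of_mem_same _ ha]
    · rintro i j hij _ ⟨a, ha, rfl⟩
      rw [Submodule.mkQ_apply, Submodule.mapQ_apply, component_apply,
        DirectSum.decompose_of_mem_ne (ℳ := 𝒜) ha fun h => hij (by omega),
        Submodule.Quotient.mk_zero]
    · intro x
      obtain ⟨a, rfl⟩ := Submodule.mkQ_surjective _ x
      classical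
      rw [← DirectSum.sum_support_decompose 𝒜 a, map_sum]
      refine sum_mem fun i _ => Submodule.mem_iSup_of_mem (i - 2 * k)
        (Submodule.mem_map_of_mem ?_)
      rw [sub_add_cancel]
      exact Subtype.prop _
  d := Submodule.mapQ _ _ C.d (C.d_mem_traceKernel hI k)
  d_mem := by
    rintro i _ ⟨a, ha, rfl⟩
    refine ⟨C.d a, ?_, rfl⟩
    have := C.d_mem _ a ha
    rwa [add_right_comm] at this
  d_d := by
    intro x
    obtain ⟨a, rfl⟩ := Submodule.mkQ_surjective _ x
    simp only [Submodule.mkQ_apply, Submodule.mapQ_apply, C.d_d]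
    rw [Submodule.Quotient.mk_eq_zero]
    refine Submodule.mem_sup_left ?_
    classical
    nth_rw 1 2 [← DirectSum.sum_support_decompose 𝒜 a]
    rw [Finset.mul_sum, Finset.sum_mul,
      ← Finset.sum_sub_distrib]
    refine sum_mem fun i _ => ?_
    have h := gradedComm_mem_commutatorSpan C.R_mem (DirectSum.decompose 𝒜 a i).2
    simpa [gradedComm, Int.negOnePow_two_mul] using h
  bracket _ _ := 0
  bracket_skew := by simp
  bracket_jacobi := by simp
  d_bracket := by simp

/-- The `k`-th semiregularity map
`A/I → A/([A,A] + I^{(k+1)}A)`, `x ↦ (1/k!) tr(R^k x)`. -/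
def semiregularity {I : Submodule K A} (hI : C.IsCurvedLieIdeal I) (k : ℕ) :
    A ⧸ I →ₗ[K] A ⧸ traceKernel 𝒜 I k :=
  I.liftQ ((k.factorial : K)⁻¹ • ((traceKernel 𝒜 I k).mkQ ∘ₗ LinearMap.mulLeft K (C.R ^ k))) (by
    intro x hx
    have : C.R ^ k * x ∈ traceKernel 𝒜 I k := by
      refine Submodule.mem_sup_right ?_
      rw [← mul_one (C.R ^ k * x), pow_succ]
      exact Submodule.mul_mem_mul (Submodule.mul_mem_mul (Submodule.pow_mem_pow I hI.R_mem k) hx)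
        trivial
    simp [(Submodule.Quotient.mk_eq_zero _).2 this])

end CurvedDGAlgebra

namespace SplitCurvedDGAlgebra

variable (S : SplitCurvedDGAlgebra 𝒜)

/-- The projection `P : A → B` with kernel `I`. -/
def P : A →ₗ[K] S.B := S.B.projectionOnto S.I S.isCompl

/-- `∂̄ = P d : B → B`. -/
def dbar : S.B →ₗ[K] S.B := S.P ∘ₗ S.d ∘ₗ S.B.subtype

/-- `∇ = P^⊥ d`, where `P^⊥ = id - P`, regarded as a map `B → A` (its values are in `I`). -/
def nabla : S.B →ₗ[K] A := (LinearMap.id - S.B.subtype ∘ₗ S.P) ∘ₗ S.d ∘ₗ S.B.subtype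

/-- The grading of `B`. -/
def degB (j : ℤ) : Submodule K S.B := (𝒜 j).comap S.B.subtype

theorem sub_P_mem (a : A) : a - S.P a ∈ S.I := by
  simpa [P] using Submodule.sub_projection_mem S.isCompl a

theorem P_eq_zero {x : A} (hx : x ∈ S.I) : S.P x = 0 := by
  simpa [P] using hx

theorem P_coe (b : S.B) : S.P b = b := by
  simp [P]

theorem P_mem {i : ℤ} {a : A} (ha : a ∈ 𝒜 i) : (S.P a : A) ∈ 𝒜 i := by
  have hb := S.B_lie.isHomogeneous i (S.P a).2
  have hI := S.I_ideal.isHomogeneous i (S.sub_P_mem a)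
  rw [DirectSum.decompose_sub, DirectSum.sub_apply, AddSubgroupClass.coe_sub,
    DirectSum.decompose_of_mem_same _ ha] at hI
  have h := S.P_eq_zero hI
  rw [map_sub, sub_eq_zero] at h
  have h' := S.P_coe ⟨_, hb⟩
  rw [h, h']
  exact (DirectSum.decompose 𝒜 (S.P a : A) i).2

theorem P_d_eq (a : A) : S.P (S.d (S.P a)) = S.P (S.d a) := by
  have := S.P_eq_zero (S.I_ideal.d_mem _ (S.sub_P_mem a))
  rw [map_sub, map_sub, sub_eq_zero] at this
  exact this.symm

theorem dbar_gradedComm {i j : ℤ} {x y : A} (hx : x ∈ 𝒜 i) (hy : y ∈ 𝒜 j) (hxB : x ∈ S.B)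
    (hyB : y ∈ S.B) :
    S.P (S.d (gradedComm i j x y)) =
      (⟨gradedComm (i + 1) j (S.P (S.d x) : A) y, S.B_lie.gradedComm_mem _ _ _ _
          (S.P_mem (S.d_mem i _ hx)) hy (S.P _).2 hyB⟩ : S.B)
        + Int.negOnePow i • (⟨gradedComm i (j + 1) x (S.P (S.d y) : A),
          S.B_lie.gradedComm_mem _ _ _ _ hx (S.P_mem (S.d_mem j _ hy)) hxB (S.P _).2⟩ : S.B) := by
  have h1 : gradedComm (i + 1) j (S.d x) y - gradedComm (i + 1) j (S.P (S.d x) : A) y ∈ S.I := by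
    rw [← gradedComm_sub_left, gradedComm_skew]
    refine neg_mem ?_
    rw [Units.smul_def]
    exact zsmul_mem (S.I_ideal.gradedComm_mem _ _ _ _ hy
      (sub_mem (S.d_mem i _ hx) (S.P_mem (S.d_mem i _ hx))) (S.sub_P_mem _)) _
  have h2 : gradedComm i (j + 1) x (S.d y) - gradedComm i (j + 1) x (S.P (S.d y) : A) ∈ S.I := by
    rw [← gradedComm_sub_right]
    exact S.I_ideal.gradedComm_mem _ _ _ _ hx
      (sub_mem (S.d_mem j _ hy) (S.P_mem (S.d_mem j _ hy))) (S.sub_P_mem _)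
  have e1 := S.P_eq_zero h1
  have e2 := S.P_eq_zero h2
  rw [map_sub, sub_eq_zero] at e1 e2
  rw [S.d_gradedComm hx hy, map_add, Units.smul_def, map_zsmul, e1, e2, Units.smul_def]
  congr 1
  · exact S.P_coe ⟨_, _⟩
  · congr 1
    exact S.P_coe ⟨_, _⟩

/-- The DG-Lie algebra `(B, ∂̄, [-,-])`, with the graded commutator of `A` as bracket. -/
def dgLie : DGLieAlgebra K S.B where
  deg := S.degB
  isInternal := by
    refine isInternal_of_proj _ (fun i => (component 𝒜 i).restrict
      (component_map_le S.B_lie.isHomogeneous i)) ?_ ?_ ?_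
    · intro i x hx
      ext
      exact DirectSum.decompose_of_mem_same 𝒜 hx
    · intro i j hij x hx
      ext
      exact DirectSum.decompose_of_mem_ne 𝒜 hx hij.symm
    · intro x
      classical
      have : x = ∑ i ∈ (DirectSum.decompose 𝒜 (x : A)).support,
          ⟨DirectSum.decompose 𝒜 (x : A) i, S.B_lie.isHomogeneous i x.2⟩ := by
        ext
        rw [AddSubmonoidClass.coe_finsetSum]
        exact (DirectSum.sum_support_decompose 𝒜 (x : A)).symm
      rw [this]
      exact sum_mem fun i _ => Submodule.mem_iSup_of_mem i
        (DirectSum.decompose 𝒜 (x : A) i).2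
  d := S.dbar
  d_mem i x hx := S.P_mem (S.d_mem i x hx)
  d_d x := by
    change S.P (S.d (S.P (S.d x))) = 0
    rw [S.P_d_eq, S.d_d]
    refine S.P_eq_zero ?_
    classical
    nth_rw 1 2 [← DirectSum.sum_support_decompose 𝒜 (x : A)]
    rw [Finset.mul_sum, Finset.sum_mul, ← Finset.sum_sub_distrib]
    refine sum_mem fun i _ => ?_
    have h := S.I_ideal.gradedComm_mem i 2 _ _ (DirectSum.decompose 𝒜 (x : A) i).2 S.R_mem
      S.I_ideal.R_mem
    rw [← neg_mem_iff]
    simpa [gradedComm, mul_comm i 2, Int.negOnePow_two_mul] using h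
  bracket i j := LinearMap.mk₂ K
    (fun x y => ⟨⟨gradedComm i j (x : S.B) (y : S.B),
      S.B_lie.gradedComm_mem i j _ _ x.2 y.2 x.1.2 y.1.2⟩, gradedComm_deg x.2 y.2⟩)
    (by intro x x' y; ext; simp [gradedComm, add_mul, mul_add]; abel)
    (by intro c x y; ext; simp [gradedComm, smul_sub, smul_comm c])
    (by intro x x' y; ext; simp [gradedComm, add_mul, mul_add]; abel)
    (by intro c x y; ext; simp [gradedComm, smul_sub, smul_comm c])
  bracket_skew i j x y := by
    ext
    simpa [Units.smul_def] using gradedComm_skew i j (x : A) (y : A)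
  bracket_jacobi i j l x y z := by
    ext
    simpa [Units.smul_def] using gradedComm_jacobi i j l (x : A) (y : A) (z : A)
  d_bracket i j x y := by
    refine (S.dbar_gradedComm x.2 y.2 x.1.2 y.1.2).trans ?_
    rfl

/-- The inclusion `ı : B → A` as an element of the convolution algebra `𝐂(B, A)`. -/
def incl : Cochain S.dgLie.deg A := Cochain.ofLinear S.dgLie.deg S.B.subtype

/-- `V^k_{i-1}(R, ∇, ı ⋆ ı) ⋆ ı`; here `w = i - 1`, and `R`, `∇`, `ı ⋆ ı` have degree two and
`ı` has degree one. -/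
def csForm (k w : ℕ) : Cochain S.dgLie.deg A :=
  conv 1
    (evalPoly
      ![Cochain.ofElement S.dgLie.deg S.R, Cochain.ofLinear S.dgLie.deg S.nabla,
        conv 1 S.incl S.incl]
      (isobaric K w (csPoly K k)))
    S.incl

/-- `σ^k = (σ^k_1, …, σ^k_{2k+1}, 0, 0, …)`, with `σ^k_i` the image of `V^k_{i-1}(R, ∇, ı ⋆ ı) ⋆ ı`
under the trace map `tr : A → A/([A,A] + I^{(k+1)}A)`. -/
def sigma (k : ℕ) : Cochain S.dgLie.deg (A ⧸ traceKernel 𝒜 S.I k) := fun i =>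
  if 1 ≤ i ∧ i ≤ 2 * k + 1 then
    (S.csForm k (i - 1)).map (traceKernel 𝒜 S.I k).mkQ i
  else 0

end SplitCurvedDGAlgebra

end Curved

end

/-! This is Chern-Simons transgression in the algebra of `A`-valued cochains on the bar construction
of `B`. Let `Q` be the bar differential and put `D f = d ∘ f - (-1)^{|f|} f ∘ Q`; this is a
derivation for `⋆`, because `d` is a derivation of `A` and `Q` a coderivation (`mapVal_d_mul`,
`bar_mul`). The inclusion behaves like a connection form: `D ı = ∇ - ı ⋆ ı` (`d_incL`). Hence `F_t =
R + t ∇ + (t² - t) ı ⋆ ı` equals `R + D(t ı) + (t ı) ⋆ (t ı)`, the curvature of `t ı`, and it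
satisfies the Bianchi identity `D F_t = -t [ı, F_t]` (`bianchi`).

Modulo commutators the trace is graded cyclic (`mul_sub_mem_commutatorSpan`), so `tr D(F_t^k ⋆ ı) =
tr (F_t^k ⋆ F_t')` (`transgression_mem`), and `k + 1` times this is the `t`-derivative of `tr
F_t^{k+1}` (`traceMap_derivative`). Integrating over `[0, 1]` gives `tr F_1^{k+1} - tr F_0^{k+1}`.
The coefficient `t² - t` vanishes at both ends, so `F_0 = R` and `F_1 = R + ∇` take values in `I`,
and both traces die modulo `I^{(k+1)} A`. Thus `∫ tr (F_t^k ⋆ ı) dt` is closed (`closedMap_csSum`);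
as the target is abelian, this is exactly the `L_∞` equation. The linear component comes from the
value `R^k` of `F_t^k` in arity zero.

The computations take place on functions of lists (`ConvAlg`), where the product and `Q` are defined
by recursion on the first element. The product there carries only the Koszul sign of the arguments;
the sign depending on `|g|` is the twist `tw`, so that `f ⋆ g` is `tw |g| f * g`. Unshuffles enter
only in the comparisons `mul_ofFn` and `compBar_eq_bar`. The integral is formal: identities known at
every scalar `t` pass to the coefficients since `K` is infinite. Finally, `Z_j` is replaced by an
element of arity `j`, so isobaric components are just components of given arity
(`lift_isobaric_apply`). -/

/-! ### Signs -/

/-- The sign `(-1)^n` as an integer. -/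
def sgn (n : ℤ) : ℤ := (Int.negOnePow n : ℤˣ)

theorem sgn_zero : sgn 0 = 1 := by simp [sgn]

theorem sgn_one : sgn 1 = -1 := by simp [sgn]

theorem sgn_add (m n : ℤ) : sgn (m + n) = sgn m * sgn n := by
  simp [sgn, Int.negOnePow_add]

theorem sgn_eq (n : ℤ) : sgn n = 1 ∨ sgn n = -1 := by
  rcases Int.units_eq_one_or (Int.negOnePow n) with h | h <;> simp [sgn, h]

theorem sgn_mul_self (n : ℤ) : sgn n * sgn n = 1 := by
  rcases sgn_eq n with h | h <;> simp [h]

theorem sgn_two_mul (n : ℤ) : sgn (2 * n) = 1 := by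
  rw [two_mul, sgn_add, sgn_mul_self]

theorem negOnePow_smul {M : Type*} [AddCommGroup M] (n : ℤ) (m : M) :
    Int.negOnePow n • m = sgn n • m := rfl

/-! ### The convolution algebra of functions on lists -/

/-- Functions from lists of elements of a type `X`, graded by `s`, to `A`. -/
def ConvAlg {X : Type*} (_ : X → ℤ) (A : Type*) : Type _ := List X → A

namespace ConvAlg

variable {X : Type*} {s : X → ℤ} {A : Type*}

/-- The total degree of a list. -/
def dg (s : X → ℤ) (l : List X) : ℤ := (l.map s).sum

@[simp] theorem dg_nil : dg s [] = 0 := rfl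

@[simp] theorem dg_cons (x : X) (l : List X) : dg s (x :: l) = s x + dg s l := by simp [dg]

/-- Insertion of `x` in the first position. -/
def der (x : X) (f : ConvAlg s A) : ConvAlg s A := fun l => f (x :: l)

theorem der_apply (x : X) (f : ConvAlg s A) (l : List X) : der x f l = f (x :: l) := rfl

@[ext] theorem ext {f g : ConvAlg s A} (h : ∀ l, f l = g l) : f = g := funext h

section Module

variable [AddCommGroup A]

instance : AddCommGroup (ConvAlg s A) := inferInstanceAs (AddCommGroup (List X → A))

instance {k : Type*} [Field k] [Module k A] : Module k (ConvAlg s A) :=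
  inferInstanceAs (Module k (List X → A))

@[simp] theorem zero_apply (l : List X) : (0 : ConvAlg s A) l = 0 := rfl

@[simp] theorem add_apply (f g : ConvAlg s A) (l : List X) : (f + g) l = f l + g l := rfl

@[simp] theorem sub_apply (f g : ConvAlg s A) (l : List X) : (f - g) l = f l - g l := rfl

@[simp] theorem neg_apply (f : ConvAlg s A) (l : List X) : (-f) l = -f l := rfl

@[simp] theorem smul_apply {k : Type*} [Field k] [Module k A] (c : k) (f : ConvAlg s A)
    (l : List X) : (c • f) l = c • f l := rfl

@[simp] theorem zsmul_apply (c : ℤ) (f : ConvAlg s A) (l : List X) : (c • f) l = c • f l := rfl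

@[simp] theorem der_zero (x : X) : der x (0 : ConvAlg s A) = 0 := rfl

@[simp] theorem der_add (x : X) (f g : ConvAlg s A) : der x (f + g) = der x f + der x g := rfl

@[simp] theorem der_smul {k : Type*} [Field k] [Module k A] (c : k) (x : X)
    (f : ConvAlg s A) : der x (c • f) = c • der x f := rfl

@[simp] theorem der_zsmul (c : ℤ) (x : X) (f : ConvAlg s A) : der x (c • f) = c • der x f := rfl

/-- The evaluation at a list. -/
def evalHom (k : Type*) [Field k] [Module k A] (l : List X) : ConvAlg s A →ₗ[k] A where
  toFun f := f l
  map_add' _ _ := rfl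
  map_smul' _ _ := rfl

@[simp] theorem evalHom_apply (k : Type*) [Field k] [Module k A] (l : List X)
    (f : ConvAlg s A) : evalHom k l f = f l := rfl

/-- The twist by the sign `(-1)^{a |l|}`. -/
def tw (a : ℤ) : ConvAlg s A →+ ConvAlg s A where
  toFun f l := sgn (a * dg s l) • f l
  map_zero' := by ext; simp
  map_add' f g := by ext l; exact smul_add _ (f l) (g l)

theorem tw_apply (a : ℤ) (f : ConvAlg s A) (l : List X) :
    tw a f l = sgn (a * dg s l) • f l := rfl

theorem tw_smul {k : Type*} [Field k] [Module k A] (a : ℤ) (c : k) (f : ConvAlg s A) :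
    tw a (c • f) = c • tw a f := by
  ext l; simp only [tw_apply, smul_apply, smul_comm c]

theorem tw_zero (f : ConvAlg s A) : tw 0 f = f := by
  ext; simp [tw_apply, sgn_zero]

theorem tw_tw (a b : ℤ) (f : ConvAlg s A) : tw a (tw b f) = tw (a + b) f := by
  ext; simp [tw_apply, smul_smul, add_mul, sgn_add]

theorem tw_one_one (f : ConvAlg s A) : tw 1 (tw 1 f) = f := by
  ext l; simp [tw_apply, smul_smul, sgn_mul_self]

theorem tw_two_mul (a : ℤ) (f : ConvAlg s A) : tw (2 * a) f = f := by
  ext; rw [tw_apply, mul_assoc, sgn_two_mul, one_smul]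

theorem tw_comm (a b : ℤ) (f : ConvAlg s A) : tw a (tw b f) = tw b (tw a f) := by
  rw [tw_tw, tw_tw, add_comm]

theorem der_tw (a : ℤ) (x : X) (f : ConvAlg s A) :
    der x (tw a f) = sgn (a * s x) • tw a (der x f) := by
  ext l; simp [der_apply, tw_apply, smul_smul, mul_add, sgn_add]

end Module

section Ring

variable [Ring A]

/-- The value of the convolution product at a list, by recursion on the list. -/
def mulAux : List X → ConvAlg s A → ConvAlg s A → A
  | [], f, g => f [] * g []
  | x :: l, f, g => mulAux l (der x f) g + mulAux l (tw (s x) f) (der x g)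

theorem mulAux_add_left (l : List X) : ∀ f f' g : ConvAlg s A,
    mulAux l (f + f') g = mulAux l f g + mulAux l f' g := by
  induction l with
  | nil => intro f f' g; simp [mulAux, add_mul]
  | cons x l ih => intro f f' g; simp only [mulAux, der_add, map_add, ih]; abel

theorem mulAux_add_right (l : List X) : ∀ f g g' : ConvAlg s A,
    mulAux l f (g + g') = mulAux l f g + mulAux l f g' := by
  induction l with
  | nil => intro f f' g; simp [mulAux, mul_add]
  | cons x l ih => intro f f' g; simp only [mulAux, der_add, ih]; abel

theorem mulAux_zero_left (l : List X) (g : ConvAlg s A) : mulAux l 0 g = 0 := by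
  simpa using mulAux_add_left l 0 0 g

theorem mulAux_zero_right (l : List X) (g : ConvAlg s A) : mulAux l g 0 = 0 := by
  simpa using mulAux_add_right l g 0 0

theorem mulAux_smul_left {k : Type*} [Field k] [Algebra k A] (c : k) (l : List X) :
    ∀ f g : ConvAlg s A, mulAux l (c • f) g = c • mulAux l f g := by
  induction l with
  | nil => intro f g; simp [mulAux]
  | cons x l ih => intro f g; simp only [mulAux, der_smul, tw_smul, ih, smul_add]

theorem mulAux_smul_right {k : Type*} [Field k] [Algebra k A] (c : k) (l : List X) :
    ∀ f g : ConvAlg s A, mulAux l f (c • g) = c • mulAux l f g := by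
  induction l with
  | nil => intro f g; simp [mulAux]
  | cons x l ih => intro f g; simp only [mulAux, der_smul, ih, smul_add]

theorem mulAux_zsmul_left (c : ℤ) (l : List X) (f g : ConvAlg s A) :
    mulAux l (c • f) g = c • mulAux l f g :=
  map_zsmul (AddMonoidHom.mk' (fun f => mulAux l f g) fun f f' => mulAux_add_left l f f' g) c f

theorem mulAux_zsmul_right (c : ℤ) (l : List X) (f g : ConvAlg s A) :
    mulAux l f (c • g) = c • mulAux l f g :=
  map_zsmul (AddMonoidHom.mk' (fun g => mulAux l f g) fun g g' => mulAux_add_right l f g g') c g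

instance : Mul (ConvAlg s A) := ⟨fun f g l => mulAux l f g⟩

theorem mul_apply (f g : ConvAlg s A) (l : List X) : (f * g) l = mulAux l f g := rfl

theorem mul_nil (f g : ConvAlg s A) : (f * g) [] = f [] * g [] := rfl

theorem der_mul (x : X) (f g : ConvAlg s A) :
    der x (f * g) = der x f * g + tw (s x) f * der x g := rfl

theorem mul_cons (f g : ConvAlg s A) (x : X) (l : List X) :
    (f * g) (x :: l) = (der x f * g) l + (tw (s x) f * der x g) l := rfl

/-- The degree is additive when a list is split between two factors, so twisting respects products.
-/
theorem mulAux_tw (a : ℤ) (l : List X) : ∀ f g : ConvAlg s A,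
    mulAux l (tw a f) (tw a g) = sgn (a * dg s l) • mulAux l f g := by
  induction l with
  | nil => intro f g; simp [mulAux, tw_apply, sgn_zero]
  | cons x l ih =>
    intro f g
    simp only [mulAux, der_tw, tw_comm (s x) a, mulAux_zsmul_left, mulAux_zsmul_right, ih, dg_cons,
      mul_add, sgn_add, mul_smul, smul_add]

theorem tw_mul (a : ℤ) (f g : ConvAlg s A) : tw a (f * g) = tw a f * tw a g := by
  ext l; rw [mul_apply, mulAux_tw]; rfl

/-- Expanding by the first element, both sides become the sum over the factor that receives it; the
factors to its left are twisted, which is consistent because `tw` is multiplicative. -/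
theorem mulAux_assoc (l : List X) : ∀ f g h : ConvAlg s A,
    mulAux l (f * g) h = mulAux l f (g * h) := by
  induction l with
  | nil => intro f g h; simp [mulAux, mul_nil, mul_assoc]
  | cons x l ih =>
    intro f g h
    simp only [mulAux, der_mul, tw_mul, mulAux_add_left, mulAux_add_right, ih, add_assoc]

/-- The function supported at the empty list. -/
def const (s : X → ℤ) (a : A) : ConvAlg s A
  | [] => a
  | _ => 0

@[simp] theorem const_nil (a : A) : const s a [] = a := rfl

@[simp] theorem const_cons (a : A) (x : X) (l : List X) : const s a (x :: l) = 0 := rfl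

@[simp] theorem der_const (a : A) (x : X) : der x (const s a) = 0 := rfl

@[simp] theorem tw_const (n : ℤ) (a : A) : tw n (const s a) = const s a := by
  ext l; cases l <;> simp [tw_apply, sgn_zero]

theorem mulAux_const_left (a : A) (l : List X) :
    ∀ f : ConvAlg s A, mulAux l (const s a) f = a * f l := by
  induction l with
  | nil => intro f; rfl
  | cons x l ih => intro f; simp [mulAux, mulAux_zero_left, ih, der_apply]

theorem mulAux_const_right (a : A) (l : List X) :
    ∀ f : ConvAlg s A, mulAux l f (const s a) = f l * a := by
  induction l with
  | nil => intro f; rfl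
  | cons x l ih => intro f; simp [mulAux, mulAux_zero_right, ih, der_apply]

instance : Ring (ConvAlg s A) :=
  { (inferInstance : AddCommGroup (ConvAlg s A)) with
    mul := (· * ·)
    one := const s 1
    left_distrib := fun f g h => ext fun l => mulAux_add_right l f g h
    right_distrib := fun f g h => ext fun l => mulAux_add_left l f g h
    zero_mul := fun f => ext fun l => mulAux_zero_left l f
    mul_zero := fun f => ext fun l => mulAux_zero_right l f
    mul_assoc := fun f g h => ext fun l => mulAux_assoc l f g h
    one_mul := fun f => ext fun l => (mulAux_const_left 1 l f).trans (one_mul _)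
    mul_one := fun f => ext fun l => (mulAux_const_right 1 l f).trans (mul_one _) }

instance {k : Type*} [Field k] [Algebra k A] : Algebra k (ConvAlg s A) :=
  Algebra.ofModule (fun c f g => ext fun l => mulAux_smul_left c l f g)
    (fun c f g => ext fun l => mulAux_smul_right c l f g)

theorem one_eq_const : (1 : ConvAlg s A) = const s 1 := rfl

theorem const_mul_apply (a : A) (f : ConvAlg s A) (l : List X) :
    (const s a * f) l = a * f l := mulAux_const_left a l f

theorem mul_const_apply (a : A) (f : ConvAlg s A) (l : List X) :
    (f * const s a) l = f l * a := mulAux_const_right a l f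

theorem tw_one' (n : ℤ) : tw n (1 : ConvAlg s A) = 1 := tw_const n 1

/-- The values of a product lie in a subgroup containing the products of the values. -/
theorem mul_apply_mem (M : AddSubgroup A) (l : List X) : ∀ (f g : ConvAlg s A),
    (∀ l₁ l₂ : List X, l₁.length + l₂.length = l.length → dg s l₁ + dg s l₂ = dg s l →
      f l₁ * g l₂ ∈ M) → (f * g) l ∈ M := by
  induction l with
  | nil => intro f g h; exact h [] [] rfl rfl
  | cons x l ih =>
    intro f g h
    rw [mul_cons]
    refine add_mem (ih _ _ fun l₁ l₂ h1 h2 => ?_) (ih _ _ fun l₁ l₂ h1 h2 => ?_)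
    · exact h (x :: l₁) l₂ (by simp; omega) (by simp; omega)
    · rw [tw_apply, smul_mul_assoc]
      exact zsmul_mem (h l₁ (x :: l₂) (by simp; omega) (by simp; omega)) _

end Ring

end ConvAlg

namespace ConvAlg

variable {X : Type*} {s : X → ℤ}

/-- The composition with an additive map. -/
def mapVal {M N : Type*} [AddCommGroup M] [AddCommGroup N] (φ : M →+ N) :
    ConvAlg s M →+ ConvAlg s N where
  toFun f l := φ (f l)
  map_zero' := by ext; simp
  map_add' f g := by ext l; exact map_add φ (f l) (g l)

@[simp] theorem mapVal_apply {M N : Type*} [AddCommGroup M] [AddCommGroup N] (φ : M →+ N)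
    (f : ConvAlg s M) (l : List X) : mapVal φ f l = φ (f l) := rfl

theorem der_mapVal {M N : Type*} [AddCommGroup M] [AddCommGroup N] (φ : M →+ N)
    (f : ConvAlg s M) (x : X) : der x (mapVal φ f) = mapVal φ (der x f) := rfl

theorem tw_mapVal {M N : Type*} [AddCommGroup M] [AddCommGroup N] (φ : M →+ N)
    (f : ConvAlg s M) (a : ℤ) : tw a (mapVal φ f) = mapVal φ (tw a f) := by
  ext l; simp [tw_apply]

/-! ### The coderivation of the bar construction, acting on functions -/

section Bar

variable {M : Type*} [AddCommGroup M]

/-- Replaces each element `y` of the list in turn by `br x y`. -/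
def adAux (br : X → X → X) (x : X) : List X → ConvAlg s M → M
  | [], _ => 0
  | y :: l, f => sgn (s x + 1) • f (br x y :: l) + sgn ((s x + 1) * s y) • adAux br x l (der y f)

/-- The value at a list of the composition with the bar differential. -/
def barAux (dX : X → X) (br : X → X → X) : List X → ConvAlg s M → M
  | [], _ => 0
  | x :: l, f => -f (dX x :: l) + adAux br x l f + sgn (s x) • barAux dX br l (der x f)

variable (dX : X → X) (br : X → X → X)

theorem adAux_add (x : X) (l : List X) :
    ∀ f g : ConvAlg s M, adAux br x l (f + g) = adAux br x l f + adAux br x l g := by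
  induction l with
  | nil => intro f g; simp [adAux]
  | cons y l ih => intro f g; simp only [adAux, der_add, ih, add_apply, smul_add]; abel

theorem barAux_add (l : List X) :
    ∀ f g : ConvAlg s M, barAux dX br l (f + g) = barAux dX br l f + barAux dX br l g := by
  induction l with
  | nil => intro f g; simp [barAux]
  | cons y l ih =>
    intro f g; simp only [barAux, der_add, ih, add_apply, smul_add, adAux_add]; abel

/-- `adAux` as an additive endomorphism. -/
def ad (x : X) : ConvAlg s M →+ ConvAlg s M :=
  AddMonoidHom.mk' (fun f l => adAux br x l f) fun f g => ext fun l => adAux_add br x l f g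

/-- The composition with the bar differential. -/
def bar : ConvAlg s M →+ ConvAlg s M :=
  AddMonoidHom.mk' (fun f l => barAux dX br l f) fun f g => ext fun l => barAux_add dX br l f g

@[simp] theorem ad_nil (x : X) (f : ConvAlg s M) : ad br x f [] = 0 := rfl

@[simp] theorem bar_nil (f : ConvAlg s M) : bar dX br f [] = 0 := rfl

theorem ad_cons (x y : X) (f : ConvAlg s M) (l : List X) : ad br x f (y :: l) =
    sgn (s x + 1) • f (br x y :: l) + sgn ((s x + 1) * s y) • ad br x (der y f) l := rfl

theorem bar_cons (x : X) (f : ConvAlg s M) (l : List X) : bar dX br f (x :: l) =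
    -f (dX x :: l) + ad br x f l + sgn (s x) • bar dX br (der x f) l := rfl

theorem der_ad (x y : X) (f : ConvAlg s M) : der y (ad br x f) =
    sgn (s x + 1) • der (br x y) f + sgn ((s x + 1) * s y) • ad br x (der y f) := rfl

theorem der_bar (x : X) (f : ConvAlg s M) : der x (bar dX br f) =
    -der (dX x) f + ad br x f + sgn (s x) • bar dX br (der x f) := rfl

theorem ad_comp {N : Type*} [AddCommGroup N] (φ : M →+ N) (x : X) (l : List X) :
    ∀ f : ConvAlg s M, ad br x (mapVal φ f) l = φ (ad br x f l) := by
  induction l with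
  | nil => intro f; simp
  | cons y l ih => intro f; simp only [ad_cons, map_add, map_zsmul, ← ih, der_mapVal, mapVal_apply]

theorem bar_comp {N : Type*} [AddCommGroup N] (φ : M →+ N) (l : List X) :
    ∀ f : ConvAlg s M, bar dX br (mapVal φ f) l = φ (bar dX br f l) := by
  induction l with
  | nil => intro f; simp
  | cons y l ih =>
    intro f
    simp only [bar_cons, map_add, map_zsmul, map_neg, ← ih, ← ad_comp, der_mapVal, mapVal_apply]

theorem bar_smul {k : Type*} [Field k] [Module k M] (c : k) (f : ConvAlg s M) :
    bar dX br (c • f) = c • bar dX br f :=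
  ext fun l => bar_comp dX br (DistribSMul.toAddMonoidHom M c) l f

variable {dX br} (hd : ∀ x, s (dX x) = s x + 1) (hb : ∀ x y, s (br x y) = s x + s y + 1)

include hb in
-- Replacing `y` by `br x y` raises the degree of the list by `s x + 1`; this is the only source of
-- the sign.
theorem ad_tw (a : ℤ) (x : X) (f : ConvAlg s M) :
    ad br x (tw a f) = sgn (a * (s x + 1)) • tw a (ad br x f) := by
  ext l
  induction l generalizing f with
  | nil => simp [tw_apply]
  | cons y l ih =>
    rw [ad_cons, der_tw, map_zsmul, zsmul_apply, ih]
    simp only [zsmul_apply, tw_apply, ad_cons, dg_cons, hb, smul_add, smul_smul, mul_add, sgn_add,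
      add_mul, mul_one, one_mul, sgn_one]
    module

include hd hb in
theorem bar_tw (a : ℤ) (f : ConvAlg s M) :
    bar dX br (tw a f) = sgn a • tw a (bar dX br f) := by
  ext l
  induction l generalizing f with
  | nil => simp [tw_apply]
  | cons y l ih =>
    rw [bar_cons, der_tw, map_zsmul, zsmul_apply, ih, ad_tw hb]
    simp only [zsmul_apply, tw_apply, bar_cons, dg_cons, hd, smul_add, smul_smul, mul_add, sgn_add,
      mul_one, smul_neg]
    module

end Bar

section Leibniz

variable {A : Type*} [Ring A] {dX : X → X} {br : X → X → X}
  (hd : ∀ x, s (dX x) = s x + 1) (hb : ∀ x y, s (br x y) = s x + s y + 1)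

include hb in
-- Inserting `x` by brackets acts on one element at a time, hence on the arguments of one factor at
-- a time. Only the degree of `br` matters here; neither skew-symmetry nor Jacobi plays a role.
theorem ad_mul (x : X) (f g : ConvAlg s A) :
    ad br x (f * g) = ad br x f * g + tw (s x + 1) f * ad br x g := by
  ext l
  induction l generalizing f g with
  | nil => simp [mul_nil]
  | cons y l ih =>
    rw [ad_cons, der_mul, map_add, add_apply, ih, ih, ad_tw hb]
    simp only [add_apply, mul_cons]
    rw [hb, der_ad, der_ad, der_tw, tw_tw, tw_tw]
    simp only [zsmul_apply, add_apply, smul_mul_assoc, mul_smul_comm, add_mul, mul_add, smul_add,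
      smul_smul, mul_comm (s y) (s x + 1), sgn_mul_self, one_smul,
      show s y + (s x + 1) = s x + s y + 1 by ring, show s x + 1 + s y = s x + s y + 1 by ring]
    abel

include hd hb in
-- Dual form of `Q` being a coderivation. A bracket of elements lying in different factors causes no
-- trouble: `br x y` goes to one factor as a single argument, which is what `ad_mul` records.
theorem bar_mul (f g : ConvAlg s A) :
    bar dX br (f * g) = bar dX br f * g + tw 1 f * bar dX br g := by
  ext l
  induction l generalizing f g with
  | nil => simp [mul_nil]
  | cons x l ih =>
    rw [bar_cons, der_mul, map_add, add_apply, ih, ih, ad_mul hb, bar_tw hd hb]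
    simp only [add_apply, mul_cons]
    rw [hd, der_bar, der_bar, der_tw, tw_tw, tw_tw, one_mul, add_comm 1 (s x)]
    simp only [zsmul_apply, add_apply, neg_apply, smul_mul_assoc, mul_smul_comm, add_mul, mul_add,
      smul_add, smul_smul, sgn_mul_self, one_smul, neg_mul, mul_neg]
    abel

end Leibniz

/-! ### Symmetric functions -/

section Symmetric

variable {M : Type*} [AddCommGroup M]

/-- Symmetry, with the Koszul sign, under the exchange of consecutive elements. -/
def IsSymm (f : ConvAlg s M) : Prop :=
  ∀ (l₁ : List X) (x y : X) (l₂ : List X),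
    f (l₁ ++ x :: y :: l₂) = sgn (s x * s y) • f (l₁ ++ y :: x :: l₂)

theorem IsSymm.der {f : ConvAlg s M} (hf : f.IsSymm) (z : X) : (der z f).IsSymm :=
  fun l₁ x y l₂ => hf (z :: l₁) x y l₂

theorem IsSymm.der_der {f : ConvAlg s M} (hf : f.IsSymm) (x y : X) :
    ConvAlg.der y (ConvAlg.der x f) = sgn (s x * s y) • ConvAlg.der x (ConvAlg.der y f) :=
  ext fun l => hf [] x y l

theorem IsSymm.tw {f : ConvAlg s M} (hf : f.IsSymm) (a : ℤ) : (tw a f).IsSymm := by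
  intro l₁ x y l₂
  simp only [tw_apply, hf l₁ x y l₂, smul_smul, dg, List.map_append, List.map_cons, List.sum_append,
    List.sum_cons, add_left_comm (s x) (s y), mul_comm]

theorem IsSymm.add {f g : ConvAlg s M} (hf : f.IsSymm) (hg : g.IsSymm) : (f + g).IsSymm := by
  intro l₁ x y l₂
  rw [add_apply, hf, hg, ← smul_add]; rfl

theorem IsSymm.smul {k : Type*} [Field k] [Module k M] {f : ConvAlg s M} (hf : f.IsSymm) (c : k) :
    (c • f).IsSymm := by
  intro l₁ x y l₂
  rw [smul_apply, hf, smul_comm]; rfl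

theorem IsSymm.comp {N : Type*} [AddCommGroup N] (φ : M →+ N) {f : ConvAlg s M} (hf : f.IsSymm) :
    (mapVal φ f).IsSymm := by
  intro l₁ x y l₂
  simp only [mapVal_apply, hf l₁ x y l₂, map_zsmul]

theorem isSymm_const {A : Type*} [Ring A] (a : A) : (const s a).IsSymm := by
  intro l₁ x y l₂; cases l₁ <;> simp

/-- Elements before the transposed pair are distributed first and do not interfere. For a pair at
the front there are four distributions: those with both elements in one factor use the symmetry of
that factor, and the two mixed ones are exchanged. -/
theorem IsSymm.mul {A : Type*} [Ring A] {f g : ConvAlg s A} (hf : f.IsSymm) (hg : g.IsSymm) :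
    (f * g).IsSymm := by
  intro l₁ x y l₂
  induction l₁ generalizing f g with
  | nil =>
    simp only [List.nil_append, mul_cons, der_tw, hf.der_der x y, hg.der_der x y, tw_comm (s y) (s x)]
    simp only [smul_mul_assoc, mul_smul_comm, zsmul_apply, smul_add, smul_smul,
      mul_comm (s y) (s x), sgn_mul_self, one_smul]
    abel
  | cons z l₁ ih =>
    simp only [List.cons_append, mul_cons, ih (hf.der z) hg, ih (hf.tw _) (hg.der z), smul_add]

end Symmetric

/-! ### Functions of given degree -/

section Degree

variable {K : Type*} [Field K] {A : Type*} [Ring A] [Algebra K A]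

/-- The functions of degree `m`. -/
def degSub (s : X → ℤ) (𝒜 : ℤ → Submodule K A) (m : ℤ) : Submodule K (ConvAlg s A) where
  carrier := {f | ∀ l, f l ∈ 𝒜 (dg s l + m)}
  add_mem' hf hg l := add_mem (hf l) (hg l)
  zero_mem' _ := zero_mem _
  smul_mem' c _ hf l := Submodule.smul_mem _ c (hf l)

variable {𝒜 : ℤ → Submodule K A} {m p : ℤ} {f g : ConvAlg s A}

theorem tw_mem_degSub (hf : f ∈ degSub s 𝒜 m) (a : ℤ) : tw a f ∈ degSub s 𝒜 m :=
  fun l => zsmul_mem (hf l) _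

theorem der_mem_degSub (hf : f ∈ degSub s 𝒜 m) (x : X) : der x f ∈ degSub s 𝒜 (s x + m) := by
  intro l
  have := hf (x :: l)
  rwa [dg_cons, show s x + dg s l + m = dg s l + (s x + m) by ring] at this

theorem const_mem_degSub {a : A} (ha : a ∈ 𝒜 m) : const s a ∈ degSub s 𝒜 m := by
  intro l
  cases l with
  | nil => simpa using ha
  | cons x l => exact zero_mem _

/-- The convolution product is graded commutative modulo commutators. -/
theorem mul_sub_mem_commutatorSpan (hf : f ∈ degSub s 𝒜 m) (hg : g ∈ degSub s 𝒜 p) (l : List X) :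
    (f * g) l - sgn (m * p) • (tw m g * tw p f) l ∈ commutatorSpan 𝒜 := by
  induction l generalizing f g m p with
  | nil =>
    have h := gradedComm_mem_commutatorSpan (hf []) (hg [])
    simpa [gradedComm, negOnePow_smul, mul_nil, tw_apply, sgn_zero] using h
  | cons x l ih =>
    have h1 := ih (der_mem_degSub hf x) hg
    have h2 := ih (tw_mem_degSub hf (s x)) (der_mem_degSub hg x)
    -- Reversing the factors interchanges the two terms of the recursion: `h1`, with `x` in `f`,
    -- matches the second term of the reversed product, and `h2` the first.
    convert add_mem h1 h2 using 1
    rw [mul_cons, mul_cons, der_tw, der_tw, tw_tw,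
      show tw (s x + p) (tw (s x) f) = tw p f by
        rw [tw_tw, add_right_comm, ← two_mul, ← tw_tw, tw_two_mul]]
    simp only [zsmul_apply, smul_mul_assoc, mul_smul_comm, smul_add, smul_smul, mul_add, add_mul,
      sgn_add, mul_comm (s x) p]
    module

variable [GradedAlgebra 𝒜]

theorem mul_mem_degSub (hf : f ∈ degSub s 𝒜 m) (hg : g ∈ degSub s 𝒜 p) :
    f * g ∈ degSub s 𝒜 (m + p) := by
  intro l
  refine mul_apply_mem (𝒜 (dg s l + (m + p))).toAddSubgroup l f g fun l₁ l₂ _ h => ?_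
  have := SetLike.mul_mem_graded (hf l₁) (hg l₂)
  rwa [show dg s l₁ + m + (dg s l₂ + p) = dg s l + (m + p) by rw [← h]; ring] at this

theorem pow_mem_degSub (hf : f ∈ degSub s 𝒜 m) (k : ℕ) : f ^ k ∈ degSub s 𝒜 (k * m) := by
  induction k with
  | zero => simpa [one_eq_const] using const_mem_degSub (s := s) (SetLike.GradedOne.one_mem (A := 𝒜))
  | succ k ih =>
    rw [pow_succ, show ((k + 1 : ℕ) : ℤ) * m = k * m + m by push_cast; ring]
    exact mul_mem_degSub ih hf

/-- The differential of `A`, applied to the values, is a twisted derivation. -/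
theorem mapVal_d_mul (C : CurvedDGAlgebra 𝒜) (hf : f ∈ degSub s 𝒜 m) (g : ConvAlg s A) :
    mapVal (C.d : A →+ A) (f * g) =
      mapVal (C.d : A →+ A) f * g + sgn m • (tw 1 f * mapVal (C.d : A →+ A) g) := by
  ext l
  induction l generalizing f g m with
  | nil =>
    have := hf []
    rw [dg_nil, zero_add] at this
    simp [mul_nil, C.d_mul _ _ _ this, tw_apply, sgn_zero, negOnePow_smul, -zsmul_eq_mul]
  | cons x l ih =>
    have h1 := ih (der_mem_degSub hf x) g
    have h2 := ih (tw_mem_degSub hf (s x)) (der x g)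
    rw [mapVal_apply] at h1 h2
    rw [mapVal_apply, mul_cons, map_add, h1, h2]
    simp only [add_apply, zsmul_apply, mul_cons, der_tw, tw_comm 1 (s x), der_mapVal, tw_mapVal,
      smul_mul_assoc, sgn_add, one_mul]
    module

end Degree

end ConvAlg

/-! ### Subtuples and unshuffle signs of tuples with a distinguished first element -/

section Subtuple

variable {X : Type*} {n : ℕ}

/-- The split according to `0 ∈ S` is the counterpart, for unshuffles, of the two terms in `mulAux`.
-/
theorem sum_finset_fin_succ {M : Type*} [AddCommMonoid M] (f : Finset (Fin (n + 1)) → M) :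
    ∑ S, f S = ∑ S : Finset (Fin n), f (S.map (Fin.succEmb n))
      + ∑ S : Finset (Fin n), f (insert 0 (S.map (Fin.succEmb n))) := by
  have h0 : (0 : Fin (n + 1)) ∉ Finset.univ.map (Fin.succEmb n) := by simp
  have h1 : (Finset.univ : Finset (Finset (Fin (n + 1)))) =
      (insert 0 (Finset.univ.map (Fin.succEmb n))).powerset := by
    ext S
    simp only [Finset.mem_univ, Finset.mem_powerset, true_iff]
    intro j _
    cases j using Fin.cases <;> simp
  have h2 : (Finset.univ.map (Fin.succEmb n)).powerset =
      Finset.univ.map (Finset.mapEmbedding (Fin.succEmb n)).toEmbedding := by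
    ext S
    simp [Finset.subset_map_iff, eq_comm]
  rw [h1, Finset.sum_powerset_insert h0, h2, Finset.sum_map, Finset.sum_map]
  rfl

/-- Written as a filtered list, a subtuple can be treated by recursion on `n`, avoiding the types
`Fin S.card`. -/
theorem ofFn_subtuple (v : Fin n → X) (S : Finset (Fin n)) :
    List.ofFn (subtuple v S) = ((List.finRange n).filter (· ∈ S)).map v := by
  have h : S.sort (· ≤ ·) = (List.finRange n).filter (· ∈ S) :=
    S.sortedLT_sort.eq_of_mem_iff
      (List.Pairwise.sortedLT ((List.sortedLT_finRange n).pairwise.filter _)) (by simp)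
  rw [← h, ← S.listMap_orderEmbOfFin_finRange rfl, List.map_map, List.ofFn_eq_map]
  rfl

theorem ofFn_subtuple_map (v : Fin (n + 1) → X) (S : Finset (Fin n)) :
    List.ofFn (subtuple v (S.map (Fin.succEmb n))) = List.ofFn (subtuple (Fin.tail v) S) := by
  rw [ofFn_subtuple, ofFn_subtuple, List.finRange_succ, List.filter_cons_of_neg (by simp),
    List.filter_map, List.map_map]
  congr 2
  ext j; simp

theorem ofFn_subtuple_insert (v : Fin (n + 1) → X) (S : Finset (Fin n)) :
    List.ofFn (subtuple v (insert 0 (S.map (Fin.succEmb n)))) =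
      v 0 :: List.ofFn (subtuple (Fin.tail v) S) := by
  rw [ofFn_subtuple, ofFn_subtuple, List.finRange_succ, List.filter_cons_of_pos (by simp),
    List.filter_map, List.map_cons, List.map_map]
  congr 3
  ext j; simp

theorem compl_map_succEmb (S : Finset (Fin n)) :
    (S.map (Fin.succEmb n))ᶜ = insert 0 (Sᶜ.map (Fin.succEmb n)) := by
  ext j; cases j using Fin.cases <;> simp

theorem compl_insert_map_succEmb (S : Finset (Fin n)) :
    (insert 0 (S.map (Fin.succEmb n)))ᶜ = Sᶜ.map (Fin.succEmb n) := by
  ext j; cases j using Fin.cases <;> simp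

/-- An index `0` in the left block is already in first position, so nothing crosses it. -/
theorem unshuffleSign_insert (e : Fin (n + 1) → ℤ) (S : Finset (Fin n)) :
    unshuffleSign e (insert 0 (S.map (Fin.succEmb n))) = unshuffleSign (Fin.tail e) S := by
  rw [unshuffleSign, unshuffleSign, compl_insert_map_succEmb, Finset.prod_product,
    Finset.prod_product, Finset.prod_map]
  refine Finset.prod_congr rfl fun i _ => ?_
  rw [Finset.prod_insert (by simp), Finset.prod_map]
  simp [Fin.tail]

/-- An index `0` in the right block is crossed by every element of `S`. The resulting sign is the
twist of the left factor in `mul_cons`. -/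
theorem unshuffleSign_map (e : Fin (n + 1) → ℤ) (S : Finset (Fin n)) :
    unshuffleSign e (S.map (Fin.succEmb n)) =
      Int.negOnePow ((e 0 - 1) * shiftedDegree (Fin.tail e) S) * unshuffleSign (Fin.tail e) S := by
  rw [unshuffleSign, unshuffleSign, compl_map_succEmb, Finset.prod_product,
    Finset.prod_product, Finset.prod_insert (by simp), Finset.prod_map, Finset.prod_map]
  congr 1
  · rw [shiftedDegree, Finset.mul_sum]
    simp only [Fin.coe_succEmb, Fin.succ_pos, if_true]
    induction S using Finset.induction_on with
    | empty => simp
    | insert a S ha ih => rw [Finset.prod_insert ha, Finset.sum_insert ha, Int.negOnePow_add, ih]; rfl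
  · refine Finset.prod_congr rfl fun i _ => ?_
    rw [Finset.prod_map]
    simp [Fin.tail]

end Subtuple

/-! ### Cochains as functions on lists -/

section ToList

variable {K : Type*} [Field K] {L : Type*} [AddCommGroup L] [Module K L]
  {W : Type*} [AddCommGroup W] [Module K W] {𝓛 : ℤ → Submodule K L}

/-- The degree in `L[1]`. -/
def shiftDeg (x : Homog 𝓛) : ℤ := x.1 - 1

/-- A cochain as a function on lists of homogeneous elements. -/
def Cochain.toList : Cochain 𝓛 W →ₗ[K] ConvAlg (shiftDeg (𝓛 := 𝓛)) W where
  toFun f l := f.eval l.get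
  map_add' _ _ := rfl
  map_smul' _ _ := rfl

open ConvAlg

/-- The length of `List.ofFn v` is only propositionally `n`; passing through the sigma type of
tuples absorbs the transport. -/
theorem Cochain.toList_ofFn (f : Cochain 𝓛 W) {n : ℕ} (v : Fin n → Homog 𝓛) :
    f.toList (List.ofFn v) = f.eval v := by
  have h := List.equivSigmaTuple.apply_symm_apply (⟨n, v⟩ : Σ n, Fin n → Homog 𝓛)
  exact congrArg (fun p : Σ n, Fin n → Homog 𝓛 => f.eval p.2) h

theorem dg_ofFn_subtuple {n : ℕ} (v : Fin n → Homog 𝓛) (S : Finset (Fin n)) :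
    dg shiftDeg (List.ofFn (subtuple v S)) = shiftedDegree (fun j => (v j).1) S := by
  rw [dg, List.map_ofFn, List.sum_ofFn, shiftedDegree]
  have h := Finset.sum_map Finset.univ (S.orderEmbOfFin rfl).toEmbedding fun j => (v j).1 - 1
  rw [S.map_orderEmbOfFin_univ rfl] at h
  exact h.symm

theorem dg_ofFn {n : ℕ} (v : Fin n → Homog 𝓛) :
    dg shiftDeg (List.ofFn v) = ∑ j, ((v j).1 - 1) := by
  rw [dg, List.map_ofFn, List.sum_ofFn]
  rfl

theorem ConvAlg.mul_ofFn {A : Type*} [Ring A] {n : ℕ} (v : Fin n → Homog 𝓛) (f g : ConvAlg (shiftDeg (𝓛 := 𝓛)) A) :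
    (f * g) (List.ofFn v) = ∑ S : Finset (Fin n), unshuffleSign (fun j => (v j).1) S •
      (f (List.ofFn (subtuple v S)) * g (List.ofFn (subtuple v Sᶜ))) := by
  induction n generalizing f g with
  | zero =>
    simp only [Finset.univ_unique, Finset.sum_singleton]
    rw [unshuffleSign, Finset.prod_eq_one fun p _ => p.1.elim0]
    simp [mul_nil, ofFn_subtuple]
  | succ n ih =>
    rw [sum_finset_fin_succ, List.ofFn_succ, mul_cons, add_comm]
    congr 1
    · refine (ih (Fin.tail v) _ _).trans (Finset.sum_congr rfl fun S _ => ?_)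
      rw [compl_map_succEmb, ofFn_subtuple_insert, ofFn_subtuple_map, unshuffleSign_map,
        tw_apply, der_apply, dg_ofFn_subtuple, mul_comm (Int.negOnePow _), mul_smul, smul_mul_assoc,
        negOnePow_smul]
      rfl
    · refine (ih (Fin.tail v) _ _).trans (Finset.sum_congr rfl fun S _ => ?_)
      rw [compl_insert_map_succEmb, ofFn_subtuple_insert, ofFn_subtuple_map, unshuffleSign_insert,
        der_apply]
      rfl

/-- The sign `(-1)^{p |x_S|}` depends only on the arguments of the left factor, so it can be
absorbed into that factor. -/
theorem toList_conv {A : Type*} [Ring A] [Algebra K A] (p : ℤ) (f g : Cochain 𝓛 A) :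
    (conv p f g).toList = tw p f.toList * g.toList := by
  ext l
  obtain ⟨n, v, rfl⟩ : ∃ n, ∃ v : Fin n → Homog 𝓛, l = List.ofFn v := ⟨_, _, (List.ofFn_get l).symm⟩
  rw [mul_ofFn, Cochain.toList_ofFn]
  have h : (conv p f g).eval v = ∑ S : Finset (Fin n),
      (unshuffleSign (fun j => (v j).1) S * Int.negOnePow (p * shiftedDegree (fun j => (v j).1) S)) •
        (f.eval (subtuple v S) * g.eval (subtuple v Sᶜ)) := by
    simp [Cochain.eval, conv, subMul, subtuple]
    rfl
  rw [h]
  refine Finset.sum_congr rfl fun S _ => ?_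
  rw [tw_apply, Cochain.toList_ofFn, Cochain.toList_ofFn, dg_ofFn_subtuple, mul_smul,
    smul_mul_assoc, negOnePow_smul]

theorem exists_ofFn_swap {X : Type*} {n : ℕ} (v : Fin (n + 1) → X) (i : Fin n) :
    ∃ l₁ l₂, List.ofFn v = l₁ ++ v i.castSucc :: v i.succ :: l₂ ∧
      List.ofFn (fun j => v (Equiv.swap i.castSucc i.succ j)) =
        l₁ ++ v i.succ :: v i.castSucc :: l₂ := by
  induction n with
  | zero => exact i.elim0
  | succ n ih =>
    cases i using Fin.cases with
    | zero =>
      refine ⟨[], List.ofFn fun j => v j.succ.succ, by simp [List.ofFn_succ], ?_⟩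
      rw [List.ofFn_succ, List.ofFn_succ]
      have h : ∀ j : Fin n, Equiv.swap (Fin.castSucc 0) (Fin.succ 0) j.succ.succ = j.succ.succ :=
        fun j => Equiv.swap_apply_of_ne_of_ne (by simp) (by simp [Fin.ext_iff])
      simp only [h, List.nil_append]
      simp
    | succ i =>
      obtain ⟨l₁, l₂, h₁, h₂⟩ := ih (Fin.tail v) i
      refine ⟨v 0 :: l₁, l₂, by rw [List.ofFn_succ]; exact congrArg _ h₁, ?_⟩
      rw [List.ofFn_succ, Equiv.swap_apply_of_ne_of_ne (by simp [Fin.ext_iff])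
        (Fin.succ_ne_zero _).symm]
      refine congrArg _ (Eq.trans ?_ h₂)
      congr 1
      ext1 j
      simp only [Fin.tail, ← Fin.succ_castSucc]
      rw [← (Fin.succ_injective _).swap_apply]

theorem Cochain.isSymmetric_of_isSymm {f : Cochain 𝓛 W} (hf : f.toList.IsSymm) :
    f.IsSymmetric := by
  intro n v i
  obtain ⟨l₁, l₂, h₁, h₂⟩ := exists_ofFn_swap v i
  rw [← Cochain.toList_ofFn, ← Cochain.toList_ofFn, h₁, h₂, hf, mul_comm]
  rfl

/-! ### The bar differential on lists -/

section Bar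

variable {br : Homog 𝓛 → Homog 𝓛 → Homog 𝓛} {dX : Homog 𝓛 → Homog 𝓛}
  (hb : ∀ x y, shiftDeg (br x y) = shiftDeg x + shiftDeg y + 1)
  {f : ConvAlg (shiftDeg (𝓛 := 𝓛)) W}

omit [Module K W] in
include hb in
-- `ad` leaves the bracket at the place of `v j`, while the unshuffle formula puts it in front; the
-- symmetry of `f` reconciles the two.
theorem ad_ofFn (hf : f.IsSymm) (x : Homog 𝓛) {n : ℕ} (v : Fin n → Homog 𝓛) :
    ad br x f (List.ofFn v) = ∑ j, unshuffleSign (fun j => (v j).1) {j} •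
      sgn (shiftDeg x + 1) • f (br x (v j) :: List.ofFn (subtuple v {j}ᶜ)) := by
  induction n generalizing f with
  | zero => simp
  | succ n ih =>
    rw [List.ofFn_succ, ad_cons, ih (hf.der _), Fin.sum_univ_succ, Finset.smul_sum]
    congr 1
    · have h0 : ({0} : Finset (Fin (n + 1))) = insert 0 ((∅ : Finset (Fin n)).map (Fin.succEmb n)) :=
        by simp
      rw [h0, compl_insert_map_succEmb, ofFn_subtuple_map, unshuffleSign_insert, unshuffleSign]
      have h1 : List.ofFn (subtuple (Fin.tail v) (∅ : Finset (Fin n))ᶜ) = List.ofFn (Fin.tail v) := by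
        rw [ofFn_subtuple]
        simp [List.ofFn_eq_map]
      rw [h1]
      simp
      rfl
    · refine Finset.sum_congr rfl fun j _ => ?_
      have hj : ({j.succ} : Finset (Fin (n + 1))) = ({j} : Finset (Fin n)).map (Fin.succEmb n) := by
        simp
      rw [hj, compl_map_succEmb, ofFn_subtuple_insert, unshuffleSign_map, der_apply]
      -- Moving the bracket past `v 0` costs `s(v 0) (s x + s(v j) + 1)`. The part with `s(v j)`
      -- cancels against the unshuffle sign and leaves the sign in the recursion of `ad`.
      have h := hf [] (br x (v j.succ)) (v 0) (List.ofFn (subtuple (Fin.tail v) {j}ᶜ))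
      rw [List.nil_append, List.nil_append] at h
      rw [h, hb, mul_smul, negOnePow_smul, Units.smul_def, Units.smul_def]
      simp only [shiftedDegree, Finset.sum_singleton, Fin.tail, smul_smul]
      congr 1
      have e := sgn_mul_self (shiftDeg (v 0) * shiftDeg (v j.succ))
      change _ = sgn (shiftDeg (v 0) * shiftDeg (v j.succ)) *
        ((unshuffleSign (fun i => (v i.succ).1) {j} : ℤˣ) * (_ * _))
      simp only [mul_comm _ (shiftDeg (v 0)), mul_add, mul_one, sgn_add]
      linear_combination (-(sgn (shiftDeg (v 0) * shiftDeg x) * sgn (shiftDeg (v 0)) *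
        (sgn (shiftDeg x) * sgn 1) * unshuffleSign (fun i => (v i.succ).1) {j})) * e

omit [Module K W] in
include hb in
theorem bar_ofFn (hf : f.IsSymm) {n : ℕ} (v : Fin n → Homog 𝓛) :
    bar dX br f (List.ofFn v) =
      ∑ i, Int.negOnePow (shiftedDegree (fun j => (v j).1) (Finset.Iio i)) •
        -f (List.ofFn (Function.update v i (dX (v i))))
      + ∑ i, ∑ j, if i < j then unshuffleSign (fun j => (v j).1) {i, j} •
          sgn (shiftDeg (v i) + 1) •
            f (br (v i) (v j) :: List.ofFn (subtuple v {i, j}ᶜ)) else 0 := by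
  induction n generalizing f with
  | zero => simp
  | succ n ih =>
    have h1 : shiftedDegree (fun j => (v j).1) (Finset.Iio (0 : Fin (n + 1))) = 0 := by
      rw [show Finset.Iio (0 : Fin (n + 1)) = ∅ by ext; simp]; rfl
    have h2 : ∀ i : Fin n, shiftedDegree (fun j => (v j).1) (Finset.Iio i.succ) =
        shiftDeg (v 0) + shiftedDegree (fun j => (v j.succ).1) (Finset.Iio i) := by
      intro i
      have : Finset.Iio i.succ = insert 0 ((Finset.Iio i).map (Fin.succEmb n)) := by
        ext j; cases j using Fin.cases <;> simp
      rw [shiftedDegree, this, Finset.sum_insert (by simp), Finset.sum_map]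
      rfl
    have e1 : ∑ i, Int.negOnePow (shiftedDegree (fun j => (v j).1) (Finset.Iio i)) •
        -f (List.ofFn (Function.update v i (dX (v i)))) = -f (dX (v 0) :: List.ofFn (Fin.tail v)) +
        sgn (shiftDeg (v 0)) • ∑ i : Fin n,
          Int.negOnePow (shiftedDegree (fun j => (v j.succ).1) (Finset.Iio i)) •
          -der (v 0) f (List.ofFn (Function.update (Fin.tail v) i (dX (v i.succ)))) := by
      rw [Fin.sum_univ_succ, h1, Finset.smul_sum]
      congr 1
      · simp [List.ofFn_succ]
        rfl
      · refine Finset.sum_congr rfl fun i _ => ?_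
        rw [h2, Int.negOnePow_add, mul_smul, negOnePow_smul, List.ofFn_succ, der_apply,
          Function.update_of_ne (Fin.succ_ne_zero i).symm]
        congr 6
        ext1 j
        simp [Function.update_apply, Fin.tail]
    have e2 : (∑ i, ∑ j, if i < j then unshuffleSign (fun j => (v j).1) {i, j} •
          sgn (shiftDeg (v i) + 1) •
            f (br (v i) (v j) :: List.ofFn (subtuple v {i, j}ᶜ)) else 0) =
        ad br (v 0) f (List.ofFn (Fin.tail v)) + sgn (shiftDeg (v 0)) •
        ∑ i : Fin n, ∑ j : Fin n, if i < j then unshuffleSign (fun j => (v j.succ).1) {i, j} •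
          sgn (shiftDeg (v i.succ) + 1) • der (v 0) f
            (br (v i.succ) (v j.succ) :: List.ofFn (subtuple (Fin.tail v) {i, j}ᶜ)) else 0 := by
      rw [Fin.sum_univ_succ, Fin.sum_univ_succ, ad_ofFn hb hf, Finset.smul_sum]
      simp only [lt_self_iff_false, if_false, zero_add, Fin.succ_pos, if_true]
      congr 1
      · refine Finset.sum_congr rfl fun j _ => ?_
        have hj : ({0, j.succ} : Finset (Fin (n + 1))) =
            insert 0 (({j} : Finset (Fin n)).map (Fin.succEmb n)) := by simp
        rw [hj, compl_insert_map_succEmb, ofFn_subtuple_map, unshuffleSign_insert]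
        rfl
      · refine Finset.sum_congr rfl fun i _ => ?_
        rw [Fin.sum_univ_succ, Finset.smul_sum]
        simp only [Fin.not_lt_zero, if_false, zero_add, Fin.succ_lt_succ_iff]
        refine Finset.sum_congr rfl fun j _ => ?_
        split_ifs with hij
        · have hj : ({i.succ, j.succ} : Finset (Fin (n + 1))) =
            ({i, j} : Finset (Fin n)).map (Fin.succEmb n) := by simp
          rw [hj, compl_map_succEmb, ofFn_subtuple_insert, unshuffleSign_map, der_apply]
          have h := hf [] (br (v i.succ) (v j.succ)) (v 0)
            (List.ofFn (subtuple (Fin.tail v) {i, j}ᶜ))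
          rw [List.nil_append, List.nil_append] at h
          rw [h, hb, mul_smul, negOnePow_smul, Units.smul_def, Units.smul_def, shiftedDegree,
            Finset.sum_pair hij.ne]
          simp only [smul_smul]
          congr 1
          change sgn (shiftDeg (v 0) * (shiftDeg (v i.succ) + shiftDeg (v j.succ))) *
            ((unshuffleSign (fun j => (v j.succ).1) {i, j} : ℤˣ) * (_ * _)) = _
          simp only [mul_comm _ (shiftDeg (v 0)), mul_add, mul_one, sgn_add]
          have e1 := sgn_mul_self (shiftDeg (v 0) * shiftDeg (v i.succ))
          have e2 := sgn_mul_self (shiftDeg (v 0) * shiftDeg (v j.succ))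
          generalize sgn (shiftDeg (v 0) * shiftDeg (v i.succ)) = a at *
          generalize sgn (shiftDeg (v 0) * shiftDeg (v j.succ)) = b at *
          generalize unshuffleSign (fun j => (v j.succ).1) {i, j} = u
          linear_combination (u : ℤ) *
            (sgn (shiftDeg (v i.succ)) * sgn 1 * sgn (shiftDeg (v 0))) * (b * b * e1 + e2)
        · rw [smul_zero]
    rw [e1, e2, List.ofFn_succ, bar_cons]
    have h3 := ih (hf.der (v 0)) (Fin.tail v)
    have h4 : ∀ (a b c d : W) (m : ℤ), -a + b + m • (c + d) = -a + m • c + (b + m • d) := by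
      intro a b c d m; rw [smul_add]; abel
    exact (congrArg _ (congrArg _ h3)).trans (h4 _ _ _ _ _)

end Bar

variable {L : Type*} [AddCommGroup L] [Module K L] (𝔏 : DGLieAlgebra K L)

/-- Since `s x = |x| - 1`, the sign `s x + 1` in the recursion is the sign `(-1)^{|x|}` of `q_2`. -/
theorem compBar_eq_bar {f : Cochain 𝔏.deg W} (hf : f.toList.IsSymm) {n : ℕ}
    (v : Fin n → Homog 𝔏.deg) :
    𝔏.compBar f v = bar 𝔏.dHomog 𝔏.bracketHomog f.toList (List.ofFn v) := by
  have hb : ∀ x y, shiftDeg (𝔏.bracketHomog x y) = shiftDeg x + shiftDeg y + 1 := by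
    intro x y; simp only [shiftDeg, DGLieAlgebra.bracketHomog]; ring
  rw [bar_ofFn hb hf, DGLieAlgebra.compBar, Finset.sum_filter, Fintype.sum_prod_type]
  simp only [Cochain.toList_ofFn, shiftDeg, sub_add_cancel, mul_smul]
  congr 1
  refine Finset.sum_congr rfl fun i _ => Finset.sum_congr rfl fun j _ => ?_
  rw [← Cochain.toList_ofFn, List.ofFn_cons]
  rfl

end ToList

namespace ConvAlg

/-! ### Functions of arity one -/

section Linear

variable {X : Type*} {s : X → ℤ} {A : Type*} [Ring A]

/-- A function of arity one. -/
def lin (s : X → ℤ) (φ : X → A) : ConvAlg s A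
  | [x] => φ x
  | _ => 0

variable (φ ψ : X → A)

@[simp] theorem lin_nil : lin s φ [] = 0 := rfl

@[simp] theorem lin_single (x : X) : lin s φ [x] = φ x := rfl

@[simp] theorem lin_cons_cons (x y : X) (l : List X) : lin s φ (x :: y :: l) = 0 := rfl

theorem der_lin (x : X) : der x (lin s φ) = const s (φ x) := by
  ext l; cases l <;> rfl

theorem tw_lin (a : ℤ) : tw a (lin s φ) = lin s fun x => sgn (a * s x) • φ x := by
  ext l
  rcases l with _ | ⟨x, _ | ⟨y, l⟩⟩ <;> simp [tw_apply, -zsmul_eq_mul]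

theorem isSymm_lin : (lin s φ).IsSymm := by
  intro l₁ x y l₂
  rcases l₁ with _ | ⟨z, _ | ⟨w, l⟩⟩ <;> simp

theorem lin_mul_lin_single (x : X) : (lin s φ * lin s ψ) [x] = 0 := by
  simp [mul_cons, mul_nil, tw_lin]

theorem lin_mul_lin_pair (x y : X) : (lin s φ * lin s ψ) [x, y] =
    φ x * ψ y + sgn (s x * s y) • (φ y * ψ x) := by
  rw [mul_cons, der_lin, der_lin, tw_lin, const_mul_apply, mul_const_apply, lin_single, lin_single,
    smul_mul_assoc]

theorem lin_mul_lin_triple (x y z : X) (l : List X) :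
    (lin s φ * lin s ψ) (x :: y :: z :: l) = 0 := by
  rw [mul_cons, der_lin, der_lin, tw_lin, const_mul_apply, mul_const_apply, lin_cons_cons,
    lin_cons_cons, mul_zero, zero_mul, add_zero]

theorem ad_const (br : X → X → X) (x : X) (a : A) : ad br x (const s a) = 0 := by
  ext l
  cases l with
  | nil => rfl
  | cons y l => rw [ad_cons, der_const, map_zero]; simp

theorem bar_const (dX : X → X) (br : X → X → X) (a : A) : bar dX br (const s a) = 0 := by
  ext l
  cases l with
  | nil => rfl
  | cons y l => rw [bar_cons, der_const, map_zero, ad_const]; simp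

theorem bar_lin_single (dX : X → X) (br : X → X → X) (x : X) :
    bar dX br (lin s φ) [x] = -φ (dX x) := by
  rw [bar_cons, bar_nil, ad_nil]; simp

theorem bar_lin_pair (dX : X → X) (br : X → X → X) (x y : X) :
    bar dX br (lin s φ) [x, y] = sgn (s x + 1) • φ (br x y) := by
  rw [bar_cons, ad_cons, der_lin, der_lin, bar_const, ad_const]; simp [-zsmul_eq_mul]

theorem bar_lin_triple (dX : X → X) (br : X → X → X) (x y z : X) (l : List X) :
    bar dX br (lin s φ) (x :: y :: z :: l) = 0 := by
  rw [bar_cons, ad_cons, der_lin, der_lin, bar_const, ad_const]; simp [-zsmul_eq_mul]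

theorem lin_mem_degSub {K : Type*} [Field K] [Algebra K A] {𝒜 : ℤ → Submodule K A} {m : ℤ}
    (h : ∀ x, φ x ∈ 𝒜 (s x + m)) : lin s φ ∈ degSub s 𝒜 m := by
  intro l
  rcases l with _ | ⟨x, _ | ⟨y, l⟩⟩
  · exact zero_mem _
  · simpa using h x
  · exact zero_mem _

end Linear

end ConvAlg

/-! ### Transgression in a split curved DG-algebra -/

noncomputable section

namespace SplitCurvedDGAlgebra

open ConvAlg hiding add_apply sub_apply

variable {K : Type*} [Field K] {A : Type*} [Ring A] [Algebra K A]
  {𝒜 : ℤ → Submodule K A} [GradedAlgebra 𝒜] (S : SplitCurvedDGAlgebra 𝒜)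

/-- The convolution algebra of `B` with values in `A`. -/
abbrev Conv : Type _ := ConvAlg (shiftDeg (𝓛 := S.dgLie.deg)) A

/-- The inclusion. -/
def incL : S.Conv := lin _ fun x => ((x.2 : S.B) : A)

/-- The map `∇`. -/
def nabL : S.Conv := lin _ fun x => S.nabla x.2

/-- The curvature `R`. -/
def curvL : S.Conv := const _ S.R

/-- The square of the inclusion. -/
def sqL : S.Conv := tw 1 S.incL * S.incL

/-- The composition with the differential of `A`. -/
def dL : S.Conv →+ S.Conv := mapVal (S.d : A →+ A)

/-- The composition with the bar differential. -/
def barL : S.Conv →+ S.Conv := bar S.dgLie.dHomog S.dgLie.bracketHomog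

theorem shiftDeg_dHomog (x : Homog S.dgLie.deg) : shiftDeg (S.dgLie.dHomog x) = shiftDeg x + 1 := by
  simp only [shiftDeg, DGLieAlgebra.dHomog]; ring

theorem shiftDeg_bracketHomog (x y : Homog S.dgLie.deg) :
    shiftDeg (S.dgLie.bracketHomog x y) = shiftDeg x + shiftDeg y + 1 := by
  simp only [shiftDeg, DGLieAlgebra.bracketHomog]; ring

theorem barL_mul (f g : S.Conv) : S.barL (f * g) = S.barL f * g + tw 1 f * S.barL g :=
  bar_mul S.shiftDeg_dHomog S.shiftDeg_bracketHomog f g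

theorem barL_tw (f : S.Conv) : S.barL (tw 1 f) = -tw 1 (S.barL f) := by
  refine (bar_tw S.shiftDeg_dHomog S.shiftDeg_bracketHomog 1 f).trans ?_
  rw [sgn_one, neg_one_smul]; rfl

theorem dL_tw (f : S.Conv) : S.dL (tw 1 f) = tw 1 (S.dL f) := (tw_mapVal _ f 1).symm

theorem dL_mul {m : ℤ} {f : S.Conv} (hf : f ∈ degSub _ 𝒜 m) (g : S.Conv) :
    S.dL (f * g) = S.dL f * g + sgn m • (tw 1 f * S.dL g) :=
  mapVal_d_mul S.toCurvedDGAlgebra hf g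

theorem shiftDeg_add_one (x : Homog S.dgLie.deg) : shiftDeg x + 1 = x.1 := by
  simp [shiftDeg]

theorem nabla_apply (b : S.B) : S.nabla b = S.d b - (S.P (S.d b) : A) := rfl

theorem nabla_mem {i : ℤ} {b : S.B} (hb : (b : A) ∈ 𝒜 i) : S.nabla b ∈ 𝒜 (i + 1) :=
  sub_mem (S.d_mem i _ hb) (S.P_mem (S.d_mem i _ hb))

theorem nabla_mem_I (b : S.B) : S.nabla b ∈ S.I := S.sub_P_mem _

theorem incL_mem : S.incL ∈ degSub _ 𝒜 1 :=
  lin_mem_degSub _ fun x => by rw [S.shiftDeg_add_one]; exact x.2.2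

theorem nabL_mem : S.nabL ∈ degSub _ 𝒜 2 := lin_mem_degSub _ fun x => by
  rw [show shiftDeg x + 2 = x.1 + 1 by simp only [shiftDeg]; ring]
  exact S.nabla_mem x.2.2

theorem curvL_mem : S.curvL ∈ degSub _ 𝒜 2 := const_mem_degSub S.R_mem

theorem sqL_mem : S.sqL ∈ degSub _ 𝒜 2 := mul_mem_degSub (tw_mem_degSub S.incL_mem 1) S.incL_mem

/-- This is `D ı = ∇ - ı ⋆ ı`, checked by arity: in arity one `d x - ∂̄ x = ∇ x`, and in arity two
the bracket from `Q` is, up to sign, the graded commutator given by `ı ⋆ ı`. -/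
theorem d_incL : S.dL S.incL + S.barL S.incL = S.nabL - S.sqL := by
  ext l
  rw [sqL, incL, tw_lin]
  rcases l with _ | ⟨x, _ | ⟨y, _ | ⟨z, l⟩⟩⟩
  · simp [dL, barL, nabL, mul_nil]
  · rw [ConvAlg.add_apply, ConvAlg.sub_apply, lin_mul_lin_single, barL, bar_lin_single]
    have h : (((S.dgLie.dHomog x).2 : S.B) : A) = S.P (S.d ((x.2 : S.B) : A)) := rfl
    rw [nabL, lin_single, S.nabla_apply, h, sub_zero, ← sub_eq_add_neg]
    rfl
  · rw [ConvAlg.add_apply, ConvAlg.sub_apply, lin_mul_lin_pair, barL, bar_lin_pair]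
    simp only [dL, nabL, mapVal_apply, lin_cons_cons, map_zero]
    have h : (((S.dgLie.bracketHomog x y).2 : S.B) : A) =
      gradedComm x.1 y.1 ((x.2 : S.B) : A) ((y.2 : S.B) : A) := rfl
    rw [h]
    simp only [gradedComm, ← S.shiftDeg_add_one, negOnePow_smul]
    simp only [one_mul, smul_mul_assoc, add_mul, mul_add, mul_one, sgn_add, sgn_one, smul_sub,
      smul_smul]
    have e := sgn_mul_self (shiftDeg x)
    generalize sgn (shiftDeg x) = a at *
    generalize sgn (shiftDeg y) = b
    generalize sgn (shiftDeg x * shiftDeg y) = c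
    rw [show a * -1 * (c * b * (a * -1)) = (a * a) * (c * b) by ring, e, one_mul]
    module
  · rw [ConvAlg.add_apply, ConvAlg.sub_apply, lin_mul_lin_triple, barL, bar_lin_triple]
    simp [dL, nabL]

/-- Both `d` and `∂̄ = P d` are derivations of the bracket on `B`, hence so is their difference. -/
theorem nabla_gradedComm {i j : ℤ} {x y : A} (hx : x ∈ 𝒜 i) (hy : y ∈ 𝒜 j) (hxB : x ∈ S.B)
    (hyB : y ∈ S.B) :
    S.nabla ⟨gradedComm i j x y, S.B_lie.gradedComm_mem i j x y hx hy hxB hyB⟩ =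
      gradedComm (i + 1) j (S.nabla ⟨x, hxB⟩) y +
        Int.negOnePow i • gradedComm i (j + 1) x (S.nabla ⟨y, hyB⟩) := by
  have h := S.d_gradedComm hx hy
  have h' := congrArg (Subtype.val) (S.dbar_gradedComm hx hy hxB hyB)
  rw [nabla_apply, nabla_apply, nabla_apply, gradedComm_sub_left, gradedComm_sub_right, smul_sub]
  refine (congrArg₂ _ h h').trans ?_
  change _ - (_ + _) = _
  rw [sub_add_sub_comm]
  rfl

/-- In arity one this is `d ∇ + ∇ ∂̄ = d² = [R, -]` on `B`, using `∂̄² = 0`; in arity two it is the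
derivation property of `∇`. -/
theorem d_nabL : S.dL S.nabL - S.barL S.nabL =
    tw 1 S.nabL * S.incL - S.incL * S.nabL + S.curvL * S.incL - S.incL * S.curvL := by
  ext l
  rw [incL, nabL, curvL, tw_lin]
  simp only [ConvAlg.add_apply, ConvAlg.sub_apply, const_mul_apply, mul_const_apply]
  rcases l with _ | ⟨x, _ | ⟨y, _ | ⟨z, l⟩⟩⟩
  · simp [dL, barL, mul_nil]
  · rw [lin_mul_lin_single, lin_mul_lin_single, barL, bar_lin_single]
    have h := S.d_d ((x.2 : S.B) : A)
    have h' : S.P (S.d (S.P (S.d ((x.2 : S.B) : A)))) = 0 := S.dgLie.d_d x.2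
    have h'' : S.nabla (S.dgLie.dHomog x).2 = S.d (S.P (S.d ((x.2 : S.B) : A)) : A) := by
      rw [nabla_apply]
      exact (congrArg (fun b : S.B => _ - (b : A)) h').trans (sub_zero _)
    rw [h'', lin_single, sub_zero, zero_add, ← h, dL, mapVal_apply, lin_single, S.nabla_apply]
    simp
  · rw [lin_mul_lin_pair, lin_mul_lin_pair, barL, bar_lin_pair]
    have h : S.nabla (S.dgLie.bracketHomog x y).2 =
        gradedComm (x.1 + 1) y.1 (S.nabla x.2) ((y.2 : S.B) : A) +
          Int.negOnePow x.1 • gradedComm x.1 (y.1 + 1) ((x.2 : S.B) : A) (S.nabla y.2) :=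
      S.nabla_gradedComm x.2.2 y.2.2 x.2.1.2 y.2.1.2
    rw [h]
    simp only [gradedComm, ← S.shiftDeg_add_one, negOnePow_smul]
    simp only [one_mul, smul_mul_assoc, add_mul, mul_add, mul_one, sgn_add, sgn_one, smul_sub,
      smul_smul, dL, mapVal_apply, lin_cons_cons, map_zero, mul_zero, zero_mul, smul_add]
    rcases sgn_eq (shiftDeg x) with e | e <;> rcases sgn_eq (shiftDeg y) with e' | e' <;>
      rw [e, e'] <;> module
  · rw [lin_mul_lin_triple, lin_mul_lin_triple, barL, bar_lin_triple]
    simp [dL]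

theorem d_curvL : S.dL S.curvL - S.barL S.curvL = 0 := by
  rw [curvL, barL, bar_const, sub_zero]
  ext l
  cases l <;> simp [dL, S.d_R]

/-- `D` is `d - Q` on even elements and `d + Q` on odd ones. This and the next lemma give its
Leibniz rule for an even left factor times an even, respectively odd, right factor. -/
theorem d_sub_bar_mul {m : ℤ} (hm : sgn m = 1) {f : S.Conv} (hf : f ∈ degSub _ 𝒜 m) (g : S.Conv) :
    S.dL (f * g) - S.barL (f * g) =
      (S.dL f - S.barL f) * g + tw 1 f * (S.dL g - S.barL g) := by
  rw [S.dL_mul hf, hm, one_smul, barL_mul, sub_mul, mul_sub]; abel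

theorem d_add_bar_tw_mul {m : ℤ} (hm : sgn m = 1) {f : S.Conv} (hf : f ∈ degSub _ 𝒜 m)
    (g : S.Conv) :
    S.dL (tw 1 f * g) + S.barL (tw 1 f * g) =
      tw 1 (S.dL f - S.barL f) * g + f * (S.dL g + S.barL g) := by
  rw [S.dL_mul (tw_mem_degSub hf 1), hm, one_smul, barL_mul, barL_tw, dL_tw, tw_one_one, map_sub,
    sub_mul, mul_add, neg_mul]; abel

/-- `D(ı ⋆ ı) = D ı ⋆ ı - ı ⋆ D ı`; on substituting `D ı = ∇ - ı ⋆ ı` the cubic terms cancel by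
associativity. -/
theorem d_sqL : S.dL S.sqL - S.barL S.sqL = tw 1 S.nabL * S.incL - S.incL * S.nabL := by
  have h := S.d_incL
  rw [← eq_sub_iff_add_eq'] at h
  rw [sqL, S.dL_mul (tw_mem_degSub S.incL_mem 1), sgn_one, neg_one_smul, barL_mul, barL_tw, dL_tw,
    tw_one_one, h]
  simp only [map_sub, sqL, tw_mul, tw_one_one]
  noncomm_ring

/-- The curvature `R + t ∇ + (t² - t) ı ⋆ ı`. -/
def curvAt (t : K) : S.Conv := S.curvL + t • S.nabL + (t ^ 2 - t) • S.sqL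

theorem curvAt_mem (t : K) : S.curvAt t ∈ degSub _ 𝒜 2 :=
  add_mem (add_mem S.curvL_mem (Submodule.smul_mem _ _ S.nabL_mem))
    (Submodule.smul_mem _ _ S.sqL_mem)

theorem curvAt_pow_mem (t : K) (k : ℕ) : S.curvAt t ^ k ∈ degSub _ 𝒜 (2 * k) := by
  rw [mul_comm]; exact pow_mem_degSub (S.curvAt_mem t) k

theorem dL_smul (c : K) (f : S.Conv) : S.dL (c • f) = c • S.dL f := by
  ext l; simp [dL]

theorem barL_smul (c : K) (f : S.Conv) : S.barL (c • f) = c • S.barL f := bar_smul _ _ c f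

theorem tw_curvL (a : ℤ) : tw a S.curvL = S.curvL := tw_const a _

/-- The Bianchi identity. -/
theorem bianchi (t : K) : S.dL (S.curvAt t) - S.barL (S.curvAt t) =
    t • (tw 1 (S.curvAt t) * S.incL - S.incL * S.curvAt t) := by
  have e : S.dL (S.curvAt t) - S.barL (S.curvAt t) =
      (S.dL S.curvL - S.barL S.curvL) + t • (S.dL S.nabL - S.barL S.nabL)
        + (t ^ 2 - t) • (S.dL S.sqL - S.barL S.sqL) := by
    simp only [curvAt, map_add, dL_smul, barL_smul]; module
  -- `ı` commutes with its own square, so the `ı ⋆ ı` part of the curvature contributes nothing to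
  -- `[ı, F_t]`, and the coefficients of the remaining terms add up to `t` for `R` and `t²` for `∇`.
  have e' : tw 1 S.sqL * S.incL = S.incL * S.sqL := by
    rw [sqL, tw_mul, tw_one_one, mul_assoc]
  rw [e, d_curvL, d_nabL, d_sqL]
  simp only [curvAt, map_add, tw_smul, add_mul, mul_add, smul_mul_assoc, mul_smul_comm, e',
    tw_curvL]
  module

theorem bianchi_pow (t : K) (k : ℕ) : S.dL (S.curvAt t ^ k) - S.barL (S.curvAt t ^ k) =
    t • (tw 1 (S.curvAt t ^ k) * S.incL - S.incL * S.curvAt t ^ k) := by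
  induction k with
  | zero =>
    have h1 : S.barL 1 = 0 := bar_const _ _ _
    have h2 : S.dL 1 = 0 := by
      have h := S.dL_mul (f := 1) (const_mem_degSub (SetLike.GradedOne.one_mem (A := 𝒜))) 1
      rw [mul_one, mul_one, tw_one', one_mul, sgn_zero, one_smul] at h
      simpa using h
    simp [h1, h2, tw_one']
  | succ k ih =>
    rw [pow_succ', S.d_sub_bar_mul (by simpa using sgn_two_mul 1) (S.curvAt_mem t), ih, bianchi, tw_mul]
    simp only [smul_mul_assoc, mul_smul_comm, ← smul_add, sub_mul, mul_sub, mul_assoc]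
    congr 1
    abel

theorem mul_sub_mul_mem {m p : ℤ} {f g : S.Conv} (hf : f ∈ degSub _ 𝒜 (2 * m))
    (hg : g ∈ degSub _ 𝒜 (2 * p)) (l : List (Homog S.dgLie.deg)) :
    (f * g) l - (g * f) l ∈ commutatorSpan 𝒜 := by
  have h := mul_sub_mem_commutatorSpan hf hg l
  rwa [mul_assoc, sgn_two_mul, one_smul, tw_two_mul, tw_two_mul] at h

/-- The derivative of the curvature. -/
def curvDeriv (t : K) : S.Conv := S.nabL + (2 * t - 1) • S.sqL

theorem curvDeriv_mem (t : K) : S.curvDeriv t ∈ degSub _ 𝒜 2 :=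
  add_mem S.nabL_mem (Submodule.smul_mem _ _ S.sqL_mem)

/-- The transgression formula, modulo commutators. -/
theorem transgression_mem (t : K) (k : ℕ) (l : List (Homog S.dgLie.deg)) :
    (S.dL (tw 1 (S.curvAt t ^ k) * S.incL) + S.barL (tw 1 (S.curvAt t ^ k) * S.incL)) l
      - (S.curvAt t ^ k * S.curvDeriv t) l ∈ commutatorSpan 𝒜 := by
  have hg : tw 1 (S.curvAt t ^ k) * S.incL ∈ degSub _ 𝒜 (2 * k + 1) :=
    mul_mem_degSub (tw_mem_degSub (S.curvAt_pow_mem t k) 1) S.incL_mem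
  -- Cyclicity for the odd elements `ı` and `F_t^k ⋆ ı`: modulo commutators, `ı ⋆ F_t^k ⋆ ı` equals
  -- `-F_t^k ⋆ ı ⋆ ı`.
  have h := mul_sub_mem_commutatorSpan (tw_mem_degSub S.incL_mem 1) hg l
  have h2 : tw (2 * k + 1 : ℤ) (tw 1 S.incL) = S.incL := by
    rw [← tw_tw, tw_two_mul, tw_one_one]
  rw [h2, one_mul, sgn_add, sgn_two_mul, sgn_one, one_mul, neg_one_smul, tw_mul, tw_one_one,
    mul_assoc (S.curvAt t ^ k)] at h
  have e : S.dL (tw 1 (S.curvAt t ^ k) * S.incL) + S.barL (tw 1 (S.curvAt t ^ k) * S.incL)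
      - S.curvAt t ^ k * S.curvDeriv t =
      -- By Leibniz, Bianchi and `d_incL`, the error in the transgression formula is exactly `-t`
      -- times the expression controlled by `h`.
      (-t) • (tw 1 S.incL * (tw 1 (S.curvAt t ^ k) * S.incL) - -(S.curvAt t ^ k * S.sqL)) := by
    rw [S.d_add_bar_tw_mul (sgn_two_mul k) (S.curvAt_pow_mem t k), bianchi_pow, d_incL, tw_smul,
      map_sub, tw_mul, tw_mul, tw_one_one, curvDeriv]
    have e1 : S.curvAt t ^ k * tw 1 S.incL * S.incL = S.curvAt t ^ k * S.sqL := by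
      rw [sqL, mul_assoc]
    simp only [smul_mul_assoc, sub_mul, e1, mul_sub, mul_add, mul_smul_comm, mul_assoc (tw 1 S.incL)]
    module
  have h' := Submodule.smul_mem _ (-t) h
  rw [← ConvAlg.sub_apply, e]
  exact h'

end SplitCurvedDGAlgebra

end

noncomputable section

/-! ### Polynomials with coefficients in an algebra -/

section Polynomials

open Polynomial

variable {K : Type*} [Field K] {F : Type*} [Ring F] [Algebra K F]

/-- Evaluation of a polynomial in a central indeterminate at a scalar. -/
def evalScalar (t : K) : F[X] →+* F :=
  eval₂RingHom' (RingHom.id F) (algebraMap K F t) fun a => (Algebra.commutes t a).symm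

theorem evalScalar_C (t : K) (a : F) : evalScalar t (C a) = a := by
  simp [evalScalar, eval₂RingHom']

theorem evalScalar_X (t : K) : evalScalar t (X : F[X]) = algebraMap K F t := by
  simp [evalScalar, eval₂RingHom']

theorem evalScalar_eq_sum (t : K) (p : F[X]) {n : ℕ} (hn : p.natDegree < n) :
    evalScalar t p = ∑ i ∈ Finset.range n, t ^ i • p.coeff i := by
  have : evalScalar t p = p.eval (algebraMap K F t) := rfl
  rw [this, eval_eq_sum, sum_over_range' _ (by simp) n hn]
  refine Finset.sum_congr rfl fun i _ => ?_
  rw [← map_pow, ← Algebra.commutes, Algebra.smul_def]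

/-- Linear functionals separate the points of `M`, which reduces the claim to scalar polynomials
vanishing on an infinite field. -/
theorem eq_zero_of_forall_sum_pow_smul [Infinite K] {M : Type*} [AddCommGroup M] [Module K M]
    (m : ℕ → M) (n : ℕ) (h : ∀ t : K, ∑ i ∈ Finset.range n, t ^ i • m i = 0) :
    ∀ i < n, m i = 0 := by
  intro i hi
  rw [← Module.forall_dual_apply_eq_zero_iff K]
  intro φ
  have h0 : (∑ j ∈ Finset.range n, monomial j (φ (m j)) : K[X]) = 0 := by
    refine Polynomial.funext fun t => ?_
    have := congrArg φ (h t)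
    simpa [eval_finsetSum, mul_comm] using this
  have := congrArg (fun p : K[X] => p.coeff i) h0
  simpa [finsetSum_coeff, coeff_monomial, hi] using this

theorem coeff_eq_of_forall_evalScalar [Infinite K] {M : Type*} [AddCommGroup M] [Module K M]
    (φ ψ : F →ₗ[K] M) (p q : F[X]) (h : ∀ t : K, φ (evalScalar t p) = ψ (evalScalar t q)) (i : ℕ) :
    φ (p.coeff i) = ψ (q.coeff i) := by
  set n := max (max p.natDegree q.natDegree) i + 1
  rw [← sub_eq_zero]
  refine eq_zero_of_forall_sum_pow_smul (K := K) (fun i => φ (p.coeff i) - ψ (q.coeff i)) n (fun t => ?_) i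
    (by omega)
  have := h t
  rw [evalScalar_eq_sum t p (n := n) (by omega), evalScalar_eq_sum t q (n := n) (by omega),
    ← sub_eq_zero] at this
  simpa [smul_sub] using this

theorem integral01_eq_sum (p : F[X]) {n : ℕ} (hn : p.natDegree < n) :
    integral01 K p = ∑ i ∈ Finset.range n, ((i : K) + 1)⁻¹ • p.coeff i :=
  sum_over_range' _ (by simp) n hn

theorem integral01_map {F' : Type*} [Ring F'] [Algebra K F'] (φ : F →ₐ[K] F') (p : F[X]) :
    φ (integral01 K p) = integral01 K (p.map (φ : F →+* F')) := by
  rw [integral01_eq_sum p (Nat.lt_succ_self _),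
    integral01_eq_sum (p.map _) (Nat.lt_succ_of_le natDegree_map_le)]
  simp

/-- If `φ ∘ p` is the derivative of `ψ ∘ q`, up to a scalar, then the integral of `φ ∘ p` is the
difference of the values of `ψ ∘ q`. -/
theorem integral01_eq_sub [CharZero K] {M : Type*} [AddCommGroup M] [Module K M]
    (φ ψ : F →ₗ[K] M) (p q : F[X]) (c : K)
    (h : ∀ t : K, c • φ (evalScalar t p) = ψ (evalScalar t (derivative q))) :
    c • φ (integral01 K p) = ψ (evalScalar (1 : K) q) - ψ (evalScalar (0 : K) q) := by
  have h1 := coeff_eq_of_forall_evalScalar (c • φ) ψ p (derivative q) h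
  set n := max p.natDegree q.natDegree + 1
  rw [integral01_eq_sum p (n := n) (by omega),
    evalScalar_eq_sum (1 : K) q (n := n + 1) (by omega),
    evalScalar_eq_sum (0 : K) q (n := n + 1) (by omega), ← map_sub, ← Finset.sum_sub_distrib,
    Finset.sum_range_succ' _ n, map_sum, Finset.smul_sum, map_add, map_sum]
  simp only [one_pow, one_smul, pow_zero, sub_self, map_zero, add_zero]
  refine Finset.sum_congr rfl fun i _ => ?_
  have h2 := h1 i
  rw [coeff_derivative, LinearMap.smul_apply] at h2
  rw [map_smul, smul_comm, h2, zero_pow (Nat.succ_ne_zero i), zero_smul, sub_zero]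
  have h3 : q.coeff (i + 1) * ((i : F) + 1) = ((i : K) + 1) • q.coeff (i + 1) := by
    rw [Algebra.smul_def, map_add, map_one, map_natCast]
    exact (((Nat.cast_commute i _).add_left (Commute.one_left _)).eq).symm
  rw [h3, map_smul, smul_smul, inv_mul_cancel₀ (Nat.cast_add_one_ne_zero i), one_smul]

/-- The coefficients need not commute, so the `n + 1` terms of the power rule stay distinct; they
are identified only after taking traces. -/
theorem derivative_pow_succ_eq_sum (p : F[X]) (n : ℕ) :
    derivative (p ^ (n + 1)) =
      ∑ i ∈ Finset.range (n + 1), p ^ i * derivative p * p ^ (n - i) := by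
  induction n with
  | zero => simp
  | succ n ih =>
    rw [pow_succ, derivative_mul, ih, Finset.sum_range_succ (n := n + 1), Finset.sum_mul]
    simp only [Nat.sub_self, pow_zero, mul_one]
    congr 1
    refine Finset.sum_congr rfl fun i hi => ?_
    rw [mul_assoc _ _ p, ← pow_succ, Nat.succ_sub (Nat.lt_succ_iff.1 (Finset.mem_range.1 hi))]

/-! ### Isobaric components -/

/-- The substitution `Z_j ↦ s^j Z_j`. -/
def weightMap : FreeAlgebra K (Fin 3) →ₐ[K] (FreeAlgebra K (Fin 3))[X] :=
  FreeAlgebra.lift K fun j => monomial (j : ℕ) (FreeAlgebra.ι K j)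

theorem sum_isobaric (V : FreeAlgebra K (Fin 3)) {n : ℕ} (hn : (weightMap V).natDegree < n) :
    ∑ i ∈ Finset.range n, isobaric K i V = V := by
  have h : ∀ V : FreeAlgebra K (Fin 3), evalScalar (1 : K) (weightMap V) = V := by
    intro V
    induction V using FreeAlgebra.induction with
    | grade0 r => rw [AlgHom.commutes]; exact evalScalar_C _ _
    | grade1 j => simp [weightMap, evalScalar, eval₂RingHom', eval₂_monomial]
    | mul a b ha hb => rw [map_mul, map_mul, ha, hb]
    | add a b ha hb => rw [map_add, map_add, ha, hb]
  conv_rhs => rw [← h V, evalScalar_eq_sum _ _ hn]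
  simp [isobaric, weightMap]

end Polynomials

namespace ConvAlg

variable {K : Type*} [Field K] {X : Type*} {s : X → ℤ} {A : Type*} [Ring A] [Algebra K A]

theorem sum_apply {ι : Type*} (t : Finset ι) (f : ι → ConvAlg s A) (l : List X) :
    (∑ i ∈ t, f i) l = ∑ i ∈ t, f i l :=
  map_sum (AddMonoidHom.mk' (fun f : ConvAlg s A => f l) fun _ _ => rfl) f t

/-- If `z_j` has arity `j`, then the isobaric component of weight `i` has arity `i`. -/
theorem lift_isobaric_apply_of_ne (z : Fin 3 → ConvAlg s A)
    (hz : ∀ (j : Fin 3) (l : List X), l.length ≠ (j : ℕ) → z j l = 0) (V : FreeAlgebra K (Fin 3)) :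
    ∀ (i : ℕ) (l : List X), l.length ≠ i → FreeAlgebra.lift K z (isobaric K i V) l = 0 := by
  change ∀ (i : ℕ) (l : List X), l.length ≠ i →
    FreeAlgebra.lift K z ((weightMap V).coeff i) l = 0
  induction V using FreeAlgebra.induction with
  | grade0 r =>
    intro i l hl
    rw [AlgHom.commutes, Polynomial.algebraMap_apply, Polynomial.coeff_C]
    split_ifs with hi
    · rw [AlgHom.commutes, Algebra.algebraMap_eq_smul_one]
      cases l with
      | nil => exact absurd hi.symm hl
      | cons x l => exact smul_zero r
    · simp
  | grade1 j =>
    intro i l hl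
    rw [weightMap, FreeAlgebra.lift_ι_apply, Polynomial.coeff_monomial]
    split_ifs with hi
    · rw [FreeAlgebra.lift_ι_apply, hz]; omega
    · simp
  | add a b ha hb =>
    intro i l hl
    rw [map_add, Polynomial.coeff_add, map_add, ConvAlg.add_apply, ha i l hl, hb i l hl, add_zero]
  | mul a b ha hb =>
    intro i l hl
    rw [map_mul, Polynomial.coeff_mul, map_sum]
    rw [ConvAlg.sum_apply]
    refine Finset.sum_eq_zero fun p hp => ?_
    rw [map_mul, ← AddSubgroup.mem_bot]
    refine mul_apply_mem _ _ _ _ fun l₁ l₂ h _ => ?_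
    rw [Finset.HasAntidiagonal.mem_antidiagonal] at hp
    rw [AddSubgroup.mem_bot]
    by_cases h1 : l₁.length = p.1
    · rw [hb p.2 l₂ (by omega), mul_zero]
    · rw [ha p.1 l₁ h1, zero_mul]

/-- The components add up to `V`, and on a list of length `i` only the one of weight `i` can be
nonzero. -/
theorem lift_isobaric_apply (z : Fin 3 → ConvAlg s A)
    (hz : ∀ (j : Fin 3) (l : List X), l.length ≠ (j : ℕ) → z j l = 0) (V : FreeAlgebra K (Fin 3)) (i : ℕ) (l : List X) :
    FreeAlgebra.lift K z (isobaric K i V) l =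
      if l.length = i then FreeAlgebra.lift K z V l else 0 := by
  split_ifs with h
  · set n := max (weightMap V).natDegree i + 1
    conv_rhs => rw [← sum_isobaric V (n := n) (by omega), map_sum,
      ConvAlg.sum_apply]
    rw [Finset.sum_eq_single i]
    · intro j _ hj
      exact lift_isobaric_apply_of_ne z hz V j l fun h' => hj (by omega)
    · intro hi
      exact absurd (Finset.mem_range.2 (by omega)) hi
  · exact lift_isobaric_apply_of_ne z hz V i l h

theorem toList_evalPoly {L : Type*} [AddCommGroup L] [Module K L] {𝓛 : ℤ → Submodule K L}
    (z : Fin 3 → Cochain 𝓛 A) (V : FreeAlgebra K (Fin 3)) :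
    (evalPoly z V).toList = FreeAlgebra.lift K (fun j => (z j).toList) V := by
  -- A word acts by successive left multiplications, so the induction needs an arbitrary argument
  -- `f` in place of the unit.
  have h : ∀ (V : FreeAlgebra K (Fin 3)) (f : Cochain 𝓛 A),
      (FreeAlgebra.lift K (fun j => evenLeftMul (z j)) V f).toList =
        FreeAlgebra.lift K (fun j => (z j).toList) V * f.toList := by
    intro V
    induction V using FreeAlgebra.induction with
    | grade0 r =>
      intro f
      rw [AlgHom.commutes, AlgHom.commutes, Module.algebraMap_end_apply, map_smul,
        Algebra.algebraMap_eq_smul_one, smul_mul_assoc, one_mul]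
    | grade1 j =>
      intro f
      rw [FreeAlgebra.lift_ι_apply, FreeAlgebra.lift_ι_apply, evenLeftMul, toList_conv, tw_zero]
    | mul a b ha hb =>
      intro f
      rw [map_mul, map_mul, Module.End.mul_apply, ha, hb, mul_assoc]
    | add a b ha hb =>
      intro f
      rw [map_add, map_add, LinearMap.add_apply, map_add, ha, hb, add_mul]
  have h1 : (Cochain.ofElement 𝓛 (1 : A)).toList = 1 := by
    ext l; cases l <;> rfl
  rw [evalPoly, h, h1, mul_one]

end ConvAlg

end

/-! ### Subspaces of symmetric functions and of functions of bounded arity -/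

noncomputable section

namespace ConvAlg

variable {K : Type*} [Field K] {X : Type*} {s : X → ℤ} {A : Type*} [Ring A] [Algebra K A]

/-- The symmetric functions. -/
def symmSub (K : Type*) [Field K] (s : X → ℤ) (A : Type*) [Ring A] [Algebra K A] :
    Submodule K (ConvAlg s A) where
  carrier := {f | f.IsSymm}
  add_mem' hf hg := hf.add hg
  zero_mem' := fun _ _ _ _ => (smul_zero _).symm
  smul_mem' c _ hf := hf.smul c

/-- The functions vanishing on lists of length greater than `n`. -/
def boundedSub (K : Type*) [Field K] (s : X → ℤ) (A : Type*) [Ring A] [Algebra K A] (n : ℕ) :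
    Submodule K (ConvAlg s A) where
  carrier := {f | ∀ l, n < l.length → f l = 0}
  add_mem' hf hg l hl := by rw [ConvAlg.add_apply, hf l hl, hg l hl, add_zero]
  zero_mem' _ _ := rfl
  smul_mem' c f hf l hl := by rw [smul_apply, hf l hl, smul_zero]

theorem mul_mem_boundedSub {m n : ℕ} {f g : ConvAlg s A} (hf : f ∈ boundedSub K s A m)
    (hg : g ∈ boundedSub K s A n) : f * g ∈ boundedSub K s A (m + n) := by
  intro l hl
  rw [← AddSubgroup.mem_bot]
  refine mul_apply_mem _ _ _ _ fun l₁ l₂ h _ => ?_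
  rw [AddSubgroup.mem_bot]
  by_cases h1 : m < l₁.length
  · rw [hf l₁ h1, zero_mul]
  · rw [hg l₂ (by omega), mul_zero]

theorem tw_mem_boundedSub {n : ℕ} {f : ConvAlg s A} (hf : f ∈ boundedSub K s A n) (a : ℤ) :
    tw a f ∈ boundedSub K s A n := by
  intro l hl
  rw [tw_apply, hf l hl, smul_zero]

theorem lin_mem_boundedSub (φ : X → A) : lin s φ ∈ boundedSub K s A 1 := by
  intro l hl
  rcases l with _ | ⟨x, _ | ⟨y, l⟩⟩
  · simp at hl
  · simp at hl
  · rfl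

theorem const_mem_boundedSub (a : A) : const s a ∈ boundedSub K s A 0 := by
  intro l hl
  cases l with
  | nil => simp at hl
  | cons x l => rfl

theorem boundedSub_mono {m n : ℕ} (h : m ≤ n) : boundedSub K s A m ≤ boundedSub K s A n :=
  fun _ hf l hl => hf l (h.trans_lt hl)

theorem pow_mem_boundedSub {n : ℕ} {f : ConvAlg s A} (hf : f ∈ boundedSub K s A n) (k : ℕ) :
    f ^ k ∈ boundedSub K s A (n * k) := by
  induction k with
  | zero => exact const_mem_boundedSub (K := K) (s := s) (1 : A)
  | succ k ih => rw [pow_succ]; exact mul_mem_boundedSub ih hf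

theorem IsSymm.pow {f : ConvAlg s A} (hf : f.IsSymm) (k : ℕ) : (f ^ k).IsSymm := by
  induction k with
  | zero => exact isSymm_const 1
  | succ k ih => rw [pow_succ]; exact ih.mul hf

theorem pow_apply_mem {I : Submodule K A} {f : ConvAlg s A} (hf : ∀ l, f l ∈ I) (k : ℕ)
    (l : List X) : (f ^ k) l ∈ I ^ k := by
  induction k generalizing l with
  | zero =>
    rw [pow_zero, pow_zero]
    cases l with
    | nil => exact Submodule.one_le.1 le_rfl
    | cons x l => exact zero_mem _
  | succ k ih =>
    rw [pow_succ, pow_succ]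
    exact mul_apply_mem (I ^ k * I).toAddSubgroup l _ _ fun l₁ l₂ _ _ =>
      Submodule.mul_mem_mul (ih l₁) (hf l₂)

/-- Evaluation at the empty list, as a homomorphism of algebras. -/
def evalNilAlgHom (K : Type*) [Field K] (s : X → ℤ) (A : Type*) [Ring A] [Algebra K A] :
    ConvAlg s A →ₐ[K] A :=
  AlgHom.ofLinearMap (evalHom K []) rfl fun _ _ => rfl

end ConvAlg

/-! ### The Chern-Simons element -/

namespace SplitCurvedDGAlgebra

open ConvAlg hiding add_apply sub_apply
open Polynomial

variable {K : Type*} [Field K] {A : Type*} [Ring A] [Algebra K A]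
  {𝒜 : ℤ → Submodule K A} [GradedAlgebra 𝒜] (S : SplitCurvedDGAlgebra 𝒜)

/-- The curvature `R + t ∇ + (t² - t) ı ⋆ ı` as a polynomial in `t`. -/
def curvPoly : S.Conv[X] := C S.curvL + X * C S.nabL + (X ^ 2 - X) * C S.sqL

theorem evalScalar_curvPoly (t : K) : evalScalar t S.curvPoly = S.curvAt t := by
  rw [curvPoly, curvAt, Algebra.smul_def, Algebra.smul_def, map_sub (algebraMap K S.Conv),
    map_pow (algebraMap K S.Conv)]
  simp only [map_add, map_mul, map_sub, map_pow, evalScalar_C, evalScalar_X]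

theorem evalScalar_derivative_curvPoly (t : K) :
    evalScalar t (derivative S.curvPoly) = S.curvDeriv t := by
  have : derivative S.curvPoly = C S.nabL + (X + X - 1) * C S.sqL := by
    simp [curvPoly, derivative_mul, sq, sub_mul, add_mul]
  rw [this, curvDeriv]
  simp only [map_add, map_mul, map_sub, evalScalar_C, evalScalar_X, add_mul, sub_mul,
    ← Algebra.smul_def, one_mul]
  module

/-- The total Chern-Simons element, without the last factor. -/
def csSum (k : ℕ) : S.Conv := (k.factorial : K)⁻¹ • integral01 K (S.curvPoly ^ k)

theorem lift_csPoly (k : ℕ) :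
    FreeAlgebra.lift K ![S.curvL, S.nabL, S.sqL] (csPoly K k) = S.csSum k := by
  rw [csPoly, map_smul, integral01_map, csSum, curvPoly]
  simp

/-- If `F_t^k` vanishes modulo `M` for every scalar `t`, so does every coefficient in `t`, and the
integral is a combination of these. It yields symmetry, degree and arity bounds without expanding
the power. -/
theorem csSum_mem [CharZero K] (k : ℕ) (M : Submodule K S.Conv)
    (h : ∀ t : K, S.curvAt t ^ k ∈ M) : S.csSum k ∈ M := by
  refine M.smul_mem _ ?_
  rw [integral01_eq_sum _ (Nat.lt_succ_self _)]
  refine sum_mem fun i _ => M.smul_mem _ ?_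
  rw [← Submodule.Quotient.mk_eq_zero, ← Submodule.mkQ_apply,
    coeff_eq_of_forall_evalScalar M.mkQ (0 : S.Conv →ₗ[K] S.Conv ⧸ M) _ (S.curvPoly ^ k)]
  · rfl
  · intro t
    rw [map_pow, evalScalar_curvPoly, LinearMap.zero_apply, Submodule.mkQ_apply,
      Submodule.Quotient.mk_eq_zero]
    exact h t

/-- The total Chern-Simons element. -/
def csTotal (k : ℕ) : S.Conv := tw 1 (S.csSum k) * S.incL

theorem isSymm_incL : S.incL.IsSymm := isSymm_lin _

theorem isSymm_sqL : S.sqL.IsSymm := (S.isSymm_incL.tw 1).mul S.isSymm_incL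

theorem sqL_mem_boundedSub : S.sqL ∈ boundedSub K _ A 2 :=
  mul_mem_boundedSub (tw_mem_boundedSub (lin_mem_boundedSub _) 1) (lin_mem_boundedSub _)

theorem isSymm_csTotal [CharZero K] (k : ℕ) : (S.csTotal k).IsSymm := by
  refine IsSymm.mul (IsSymm.tw ?_ 1) S.isSymm_incL
  refine S.csSum_mem k (symmSub K _ A) fun t => IsSymm.pow (f := S.curvAt t) ?_ k
  exact ((isSymm_const _).add ((isSymm_lin _).smul t)).add (S.isSymm_sqL.smul _)

theorem csTotal_mem_degSub [CharZero K] (k : ℕ) : S.csTotal k ∈ degSub _ 𝒜 (2 * k + 1) :=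
  mul_mem_degSub (tw_mem_degSub (S.csSum_mem k _ fun t => S.curvAt_pow_mem t k) 1) S.incL_mem

theorem csTotal_mem_boundedSub [CharZero K] (k : ℕ) :
    S.csTotal k ∈ boundedSub K _ A (2 * k + 1) := by
  refine mul_mem_boundedSub (tw_mem_boundedSub ?_ 1) (lin_mem_boundedSub _)
  refine S.csSum_mem k _ fun t => pow_mem_boundedSub ?_ k
  exact add_mem (add_mem (boundedSub_mono (Nat.zero_le _) (const_mem_boundedSub _))
    (Submodule.smul_mem _ _ (boundedSub_mono one_le_two (lin_mem_boundedSub _))))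
    (Submodule.smul_mem _ _ S.sqL_mem_boundedSub)

theorem csTotal_nil (k : ℕ) : S.csTotal k [] = 0 := by
  rw [csTotal, mul_nil, incL, lin_nil, mul_zero]

/-- Evaluation at the empty list is an algebra homomorphism killing `∇` and `ı ⋆ ı`, so the
integrand becomes the constant `R^k`. -/
theorem csSum_nil (k : ℕ) : S.csSum k [] = (k.factorial : K)⁻¹ • S.R ^ k := by
  have h : evalNilAlgHom K _ A (S.csSum k) = (k.factorial : K)⁻¹ • S.R ^ k := by
    have h1 : evalNilAlgHom K _ A S.curvL = S.R := rfl
    have h2 : evalNilAlgHom K _ A S.nabL = 0 := rfl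
    have h3 : evalNilAlgHom K _ A S.sqL = 0 := mul_zero _
    rw [csSum, map_smul, integral01_map, Polynomial.map_pow, curvPoly]
    simp only [Polynomial.map_add, Polynomial.map_mul, map_C, RingHom.coe_coe, h1, h2, h3, map_zero,
      mul_zero, add_zero, ← C_pow]
    rw [integral01, sum_C_index] <;> simp
  exact h

theorem csTotal_single (k : ℕ) (b : Homog S.dgLie.deg) :
    S.csTotal k [b] = (k.factorial : K)⁻¹ • (S.R ^ k * ((b.2 : S.B) : A)) := by
  rw [csTotal, mul_cons, mul_nil, mul_nil, incL, der_lin, lin_nil, mul_zero, zero_add, tw_tw,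
    tw_apply, csSum_nil]
  simp [sgn_zero]

/-! ### The closedness of the Chern-Simons element modulo the trace kernel -/

theorem curvAt_one : S.curvAt 1 = S.curvL + S.nabL := by simp [curvAt]

theorem curvAt_zero : S.curvAt 0 = S.curvL := by simp [curvAt]

theorem pow_apply_mem_traceKernel {f : S.Conv} (hf : ∀ l, f l ∈ S.I) (k : ℕ)
    (l : List (Homog S.dgLie.deg)) : (f ^ (k + 1)) l ∈ traceKernel 𝒜 S.I k := by
  refine Submodule.mem_sup_right ?_
  rw [← mul_one ((f ^ (k + 1)) l)]
  exact Submodule.mul_mem_mul (pow_apply_mem hf (k + 1) l) trivial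

theorem curvL_apply_mem (l : List (Homog S.dgLie.deg)) : S.curvL l ∈ S.I := by
  cases l with
  | nil => exact S.I_ideal.R_mem
  | cons x l => exact zero_mem _

theorem nabL_apply_mem (l : List (Homog S.dgLie.deg)) : S.nabL l ∈ S.I := by
  rcases l with _ | ⟨x, _ | ⟨y, l⟩⟩
  · exact zero_mem _
  · exact S.nabla_mem_I _
  · exact zero_mem _

/-- `f ↦ tr ((d + Q) (f ⋆ ı))`, for `f` even, at the list `l`. -/
def closedMap (k : ℕ) (l : List (Homog S.dgLie.deg)) : S.Conv →ₗ[K] A ⧸ traceKernel 𝒜 S.I k where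
  toFun f := (traceKernel 𝒜 S.I k).mkQ ((S.dL (tw 1 f * S.incL) + S.barL (tw 1 f * S.incL)) l)
  map_add' f g := by
    rw [← map_add, ← ConvAlg.add_apply]
    simp only [map_add, add_mul]
    rw [add_add_add_comm]
  map_smul' c f := by
    rw [tw_smul, smul_mul_assoc, dL_smul, barL_smul, ← smul_add, ConvAlg.smul_apply, map_smul]; rfl

/-- `f ↦ tr f` at the list `l`. -/
def traceMap (k : ℕ) (l : List (Homog S.dgLie.deg)) : S.Conv →ₗ[K] A ⧸ traceKernel 𝒜 S.I k :=
  (traceKernel 𝒜 S.I k).mkQ ∘ₗ evalHom K l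

theorem mkQ_eq_of_sub_mem {k : ℕ} {a b : A} (h : a - b ∈ commutatorSpan 𝒜) :
    (traceKernel 𝒜 S.I k).mkQ a = (traceKernel 𝒜 S.I k).mkQ b :=
  (Submodule.Quotient.eq _).2 (Submodule.mem_sup_left h)

/-- Under the trace, even elements can be permuted cyclically, so each of the `k + 1` terms in the
derivative of `F_t^{k+1}` equals `tr (F_t^k ⋆ F_t')`, to which the transgression formula applies. -/
theorem traceMap_derivative (k : ℕ) (l : List (Homog S.dgLie.deg)) (t : K) :
    ((k : K) + 1) • S.closedMap k l (evalScalar t (S.curvPoly ^ k)) =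
      S.traceMap k l (evalScalar t (derivative (S.curvPoly ^ (k + 1)))) := by
  have h1 : S.closedMap k l (S.curvAt t ^ k) = S.traceMap k l (S.curvAt t ^ k * S.curvDeriv t) :=
    S.mkQ_eq_of_sub_mem (S.transgression_mem t k l)
  have h2 : ∀ i ∈ Finset.range (k + 1),
      S.traceMap k l (S.curvAt t ^ i * S.curvDeriv t * S.curvAt t ^ (k - i)) =
        S.traceMap k l (S.curvAt t ^ k * S.curvDeriv t) := by
    intro i hi
    have hm : S.curvAt t ^ i * S.curvDeriv t ∈ degSub _ 𝒜 (2 * (i + 1)) := by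
      rw [mul_add, mul_one]
      exact mul_mem_degSub (S.curvAt_pow_mem t i) (S.curvDeriv_mem t)
    refine (S.mkQ_eq_of_sub_mem (S.mul_sub_mul_mem hm (S.curvAt_pow_mem t (k - i)) l)).trans ?_
    rw [← mul_assoc, ← pow_add, Nat.sub_add_cancel (Nat.lt_succ_iff.1 (Finset.mem_range.1 hi))]
    rfl
  rw [map_pow, evalScalar_curvPoly, h1, derivative_pow_succ_eq_sum, map_sum, map_sum]
  simp only [map_mul, map_pow, evalScalar_curvPoly, evalScalar_derivative_curvPoly]
  rw [Finset.sum_congr rfl h2, Finset.sum_const, Finset.card_range, ← Nat.cast_smul_eq_nsmul K]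
  push_cast
  rfl

/-- The fundamental theorem of calculus for `tr F_t^{k+1}`: at both ends `F_t` takes values in `I`,
so its `(k+1)`-st power lies in the trace kernel. The factor `k + 1` is then cancelled in
characteristic zero. -/
theorem closedMap_csSum [CharZero K] (k : ℕ) (l : List (Homog S.dgLie.deg)) :
    S.closedMap k l (S.csSum k) = 0 := by
  have h := integral01_eq_sub _ _ _ _ _ (S.traceMap_derivative k l)
  have h0 : S.traceMap k l (S.curvL ^ (k + 1)) = 0 :=
    (Submodule.Quotient.mk_eq_zero _).2 (S.pow_apply_mem_traceKernel S.curvL_apply_mem k l)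
  have h1 : S.traceMap k l ((S.curvL + S.nabL) ^ (k + 1)) = 0 :=
    (Submodule.Quotient.mk_eq_zero _).2 (S.pow_apply_mem_traceKernel
      (fun l => add_mem (S.curvL_apply_mem l) (S.nabL_apply_mem l)) k l)
  rw [map_pow (evalScalar _), map_pow (evalScalar _), evalScalar_curvPoly, evalScalar_curvPoly,
    curvAt_one, curvAt_zero, h0, h1,
    sub_zero, smul_eq_zero_iff_right (Nat.cast_add_one_ne_zero k)] at h
  rw [csSum, map_smul, h, smul_zero]

/-! ### Comparison with the cochains -/

theorem toList_incl : S.incl.toList = S.incL := by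
  ext l
  rcases l with _ | ⟨x, _ | ⟨y, l⟩⟩ <;> rfl

theorem toList_nabla : (Cochain.ofLinear S.dgLie.deg S.nabla).toList = S.nabL := by
  ext l
  rcases l with _ | ⟨x, _ | ⟨y, l⟩⟩ <;> rfl

theorem toList_R : (Cochain.ofElement S.dgLie.deg S.R).toList = S.curvL := by
  ext l
  cases l <;> rfl

theorem generator_apply (j : Fin 3) (l : List (Homog S.dgLie.deg)) (hl : l.length ≠ (j : ℕ)) :
    (![S.curvL, S.nabL, S.sqL] : Fin 3 → S.Conv) j l = 0 := by
  fin_cases j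
  · cases l with
    | nil => simp at hl
    | cons x l => rfl
  · rcases l with _ | ⟨x, _ | ⟨y, l⟩⟩
    · rfl
    · simp at hl
    · rfl
  · change S.sqL l = 0
    rw [sqL, incL, tw_lin]
    rcases l with _ | ⟨x, _ | ⟨y, _ | ⟨z, l⟩⟩⟩
    · exact mul_zero _
    · exact lin_mul_lin_single _ _ _
    · simp at hl
    · exact lin_mul_lin_triple _ _ _ _ _ _

/-- The weight `w` component is the restriction of the total element to arity `w`, and the last
factor `ı` takes exactly one more argument. -/
theorem toList_csForm (k w : ℕ) (l : List (Homog S.dgLie.deg)) :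
    (S.csForm k w).toList l = if l.length = w + 1 then S.csTotal k l else 0 := by
  have hz : (fun j => ((![Cochain.ofElement S.dgLie.deg S.R, Cochain.ofLinear S.dgLie.deg S.nabla,
      conv 1 S.incl S.incl] : Fin 3 → Cochain S.dgLie.deg A) j).toList) =
      ![S.curvL, S.nabL, S.sqL] := by
    funext j
    fin_cases j
    · exact S.toList_R
    · exact S.toList_nabla
    · change (conv 1 S.incl S.incl).toList = _
      rw [toList_conv, toList_incl]; rfl
  rw [csForm, toList_conv, toList_evalPoly, hz, toList_incl]
  set f := FreeAlgebra.lift K ![S.curvL, S.nabL, S.sqL] (isobaric K w (csPoly K k)) with hf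
  have hfl : ∀ l, f l = if l.length = w then S.csSum k l else 0 := fun l => by
    rw [hf, lift_isobaric_apply _ S.generator_apply, lift_csPoly]
  have hi : ∀ l : List (Homog S.dgLie.deg), l.length ≠ 1 → S.incL l = 0 :=
    fun l h => by
      rcases l with _ | ⟨x, _ | ⟨y, l⟩⟩
      · rfl
      · simp at h
      · rfl
  split_ifs with hl
  -- The isobaric component and the whole `csSum` agree on lists of length `w`, the only ones left
  -- for the first factor once `ı` has taken its single argument.
  · rw [csTotal, ← sub_eq_zero, ← ConvAlg.sub_apply, ← sub_mul, ← map_sub, ← AddSubgroup.mem_bot]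
    refine mul_apply_mem _ _ _ _ fun l₁ l₂ h _ => ?_
    rw [AddSubgroup.mem_bot]
    by_cases h1 : l₂.length = 1
    · rw [tw_apply, ConvAlg.sub_apply, hfl, if_pos (by omega), sub_self, smul_zero, zero_mul]
    · rw [hi l₂ h1, mul_zero]
  · rw [← AddSubgroup.mem_bot]
    refine mul_apply_mem _ _ _ _ fun l₁ l₂ h _ => ?_
    rw [AddSubgroup.mem_bot]
    by_cases h1 : l₂.length = 1
    · rw [tw_apply, hfl, if_neg (by omega), smul_zero, zero_mul]
    · rw [hi l₂ h1, mul_zero]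

theorem csForm_eval (k w n : ℕ) (v : Fin n → Homog S.dgLie.deg) :
    (S.csForm k w).eval v = if n = w + 1 then S.csTotal k (List.ofFn v) else 0 := by
  rw [← Cochain.toList_ofFn, toList_csForm, List.length_ofFn]

/-- The cut-offs in `sigma` lose nothing: the total element vanishes in arity zero, where `ı` does,
and above `2k + 1`, since `F_t` has arity at most two. -/
theorem sigma_eval [CharZero K] (k n : ℕ) (v : Fin n → Homog S.dgLie.deg) :
    (S.sigma k).eval v = (traceKernel 𝒜 S.I k).mkQ (S.csTotal k (List.ofFn v)) := by
  rw [Cochain.eval, sigma]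
  split_ifs with hn
  · refine (congrArg (traceKernel 𝒜 S.I k).mkQ (S.csForm_eval k (n - 1) n v)).trans ?_
    rw [if_pos (by omega)]
  · have : S.csTotal k (List.ofFn v) = 0 := by
      rcases Nat.eq_zero_or_pos n with rfl | h
      · rw [List.ofFn_zero, csTotal_nil]
      · exact S.csTotal_mem_boundedSub k _ (by rw [List.length_ofFn]; omega)
    rw [this, map_zero]
    rfl

theorem toList_sigma [CharZero K] (k : ℕ) : (S.sigma k).toList =
    mapVal ((traceKernel 𝒜 S.I k).mkQ : A →+ A ⧸ traceKernel 𝒜 S.I k) (S.csTotal k) := by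
  ext l
  have h := S.sigma_eval k _ l.get
  rw [List.ofFn_get] at h
  exact h

theorem isHom_csForm [CharZero K] (k w : ℕ) : (S.csForm k w).IsHom 𝒜 (2 * k + 1) (w + 1) where
  isSymmetric := by
    refine Cochain.isSymmetric_of_isSymm fun l₁ x y l₂ => ?_
    rw [toList_csForm, toList_csForm, S.isSymm_csTotal k l₁ x y l₂]
    simp only [List.length_append, List.length_cons]
    split_ifs <;> simp
  hasDegree := by
    intro n v
    rw [csForm_eval, ← dg_ofFn]
    split_ifs
    · exact S.csTotal_mem_degSub k _
    · exact zero_mem _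
  eq_zero := by
    intro n hn
    funext e
    ext x
    have h := S.csForm_eval k w n fun j => ⟨e j, x j⟩
    rw [if_neg hn] at h
    exact h

theorem isLInftyMorphism_sigma [CharZero K] (k : ℕ) :
    IsLInftyMorphism S.dgLie (S.traceQuotient S.I_ideal k) (S.sigma k) where
  zero := by simp [sigma]
  isSymmetric := by
    refine Cochain.isSymmetric_of_isSymm ?_
    rw [toList_sigma]
    exact (S.isSymm_csTotal k).comp _
  hasDegree := by
    intro n v
    rw [sigma_eval, ← dg_ofFn]
    refine Submodule.mem_map_of_mem ?_
    have h := S.csTotal_mem_degSub k (List.ofFn v)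
    rwa [show dg shiftDeg (List.ofFn v) + (2 * k + 1 : ℤ) = dg shiftDeg (List.ofFn v) + 1 + 2 * k by
      ring] at h
  comm := by
    intro n v
    have h : (S.traceQuotient S.I_ideal k).d ((S.sigma k).eval v) +
        S.dgLie.compBar (S.sigma k) v = 0 := by
      rw [compBar_eq_bar _ (by rw [toList_sigma]; exact (S.isSymm_csTotal k).comp _),
        sigma_eval, toList_sigma, bar_comp]
      -- The trace projection commutes with `d` and with composition by `Q`, so closedness of the
      -- Chern-Simons element is the identity `d σ + σ Q = 0`.
      have h1 := S.closedMap_csSum k (List.ofFn v)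
      change (traceKernel 𝒜 S.I k).mkQ (_ + _) = 0 at h1
      rwa [map_add] at h1
    -- The quadratic part of the `L_∞` equation disappears because the target bracket is zero.
    rw [eq_neg_of_add_eq_zero_right h, Finset.sum_eq_zero, smul_zero, add_zero]
    intro T _
    exact smul_zero _

end SplitCurvedDGAlgebra

end

theorem corollary5p3 {K : Type*} [Field K] [CharZero K] {A : Type*} [Ring A] [Algebra K A]
    (𝒜 : ℤ → Submodule K A) [GradedAlgebra 𝒜] (S : SplitCurvedDGAlgebra 𝒜) (k : ℕ) :
    -- `V^k_{i-1}(R, ∇, ı ⋆ ı) ⋆ ı` is an element of `𝐂(B, A)_i` of degree `2k + 1`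
    (∀ i : ℕ, 1 ≤ i → i ≤ 2 * k + 1 → (S.csForm k (i - 1)).IsHom 𝒜 (2 * k + 1) i) ∧
    -- `σ^k` is an `L_∞` morphism
    IsLInftyMorphism S.dgLie (S.traceQuotient S.I_ideal k) (S.sigma k) ∧
    -- its linear component is the `k`-th semiregularity map, under `B ≅ A/I`
    (∀ b : Homog S.dgLie.deg,
      (S.sigma k).eval ![b] = S.semiregularity S.I_ideal k (S.I.mkQ (b.2 : S.B))) := by
  refine ⟨fun i h1 _ => ?_, S.isLInftyMorphism_sigma k, fun b => ?_⟩
  · have h := S.isHom_csForm k (i - 1)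
    rwa [Nat.sub_add_cancel h1] at h
  · rw [S.sigma_eval, List.ofFn_succ, List.ofFn_zero]
    exact (congrArg _ (S.csTotal_single k b)).trans (map_smul _ _ _)
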